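/- Write $\mathcal A(X)$ for the set of closed subsets of a computable metric space $(X,d,\alpha)$, i.e. a metric space with a dense sequence $\alpha:\mathbb N\to X$ such that $(m,n)\mapsto d(\alpha(m),\alpha(n))$ is a computable double sequence of reals. Representations are surjective partial maps from $\mathbb N^{\mathbb N}$. Points of $X$ are represented by the Cauchy representation: $p$ is a name of $\lim_n\alpha(p(n))$ if this limit exists and $d(\alpha(p(n)),\alpha(p(k)))<2^{-k}$ for all $n\ge k$. Let $\psi_-$ and $\psi_+$ be the negative and the positive representation of $\mathcal A(X)$: a $\psi_-$-name of $A$ lists open balls $B(\alpha(n),r)$, $r\in\mathbb Q$, with union $X\setminus A$, and a $\psi_+$-name of $A$ is a name of a sequence in $X\sqcup\{\infty\}$ whose members in $X$ form a dense subset of $A$ (the isolated dummy point $\infty$ allows $A=\emptyset$). For a representation $\delta$ let $\delta'=\delta\circ\lim$ be its jump, where $\lim$ is the limit map on Baire space (on coded sequences of elements of $\mathbb N^{\mathbb N}$); the jump $f'$ of a problem $f$ is $f$ with its input representation replaced by the jump of it. Let $\psi_\#$ be the representation of $\mathcal A(2^{\mathbb N})$ with $$\psi_\#(p)=2^{\mathbb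 N}\setminus\bigcup_{w\in\psi_-(p)}w2^{\mathbb N},$$ where on the right-hand side $\psi_-$ is the negative representation of the subsets of the discrete space $\{0,1\}^*$. For a computable Polish (i.e. complete computable metric) space $X$, let $\mathsf{BCT}_{0,X}$ and $\mathsf{BCT}_{2,X}$ be the problem $$(A_i)_{i\in\mathbb N}\mapsto X\setminus\bigcup_{i\in\mathbb N}A_i,\qquad \text{defined for all sequences of closed sets } A_i\subseteq X \text{ with } A_i^\circ=\emptyset \text{ for all } i,$$ where the $A_i$ are given with respect to $\psi_-$ in case of $\mathsf{BCT}_{0,X}$ and with respect to $\psi_+$ in case of $\mathsf{BCT}_{2,X}$. Let $\Pi^0_1\mathsf G$ be the same problem for $X=2^{\mathbb N}$ where the $A_i$ are given with respect to $\psi_\#$. Let $\equiv_{\mathrm{sW}}$ denote strong Weihrauch equivalence. Then: 1. The identity on $\mathcal A(2^{\mathbb N})$ is computable from $\psi_-'$ to $\psi_\#$ and from $\psi_\#$ to $\psi_-'$, i.e. $\psi_-'\equiv\psi_\#$ on the closed subsets of Cantor space. 2. For every computable perfect Polish space $X$ (perfect: without isolated points), $$\Pi^0_1\mathsf G\equiv_{\mathrm{sW}}\mathsf{BCT}_{2,X}\equiv_{\mathrm{sW}}\mathsf{BCT}_{0,X}'.$$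 -/

import Mathlib

open Set Filter Topology TopologicalSpace

namespace CompAnalysis

/-! ### Computable functions on Baire space -/

/-- The finite prefix `p(0), …, p(n-1)` of a sequence. -/
def pref (p : ℕ → ℕ) (n : ℕ) : List ℕ := (List.range n).map p

/-- A partial function `F` on Baire space is computable if some computable monotone word
function `φ` approximates it: `F(p)` is the supremum of the words `φ(p(0)…p(m-1))` for every `p`
in the domain of `F`.  (As usual, restrictions of computable functions count as computable.) -/
def ComputableFun (F : (ℕ → ℕ) →. (ℕ → ℕ)) : Prop :=
  ∃ φ : List ℕ → List ℕ, Computable φ ∧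
    (∀ u v : List ℕ, u <+: v → φ u <+: φ v) ∧
    ∀ p q : ℕ → ℕ, q ∈ F p →
      (∀ m, ∃ n, φ (pref p m) = pref q n) ∧ (∀ n, ∃ m, pref q n <+: φ (pref p m))

/-! ### Represented spaces -/

/-- A representation of `X`: a surjective partial map from Baire space onto `X`, given through its
graph; `names p x` says that `p` is a name of `x`. -/
structure Representation (X : Type*) where
  names : (ℕ → ℕ) → X → Prop
  unique : ∀ p x y, names p x → names p y → x = y
  surj : ∀ x, ∃ p, names p x

namespace Representation

variable {X : Type*}

/-- The sequence `i ↦ p_i` coded by `p = ⟨p_0, p_1, …⟩`, where `p⟨i, j⟩ = p_i(j)`. -/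
def row (p : ℕ → ℕ) (i : ℕ) : ℕ → ℕ := fun j => p (Nat.pair i j)

/-- The code `⟨p_0, p_1, …⟩` of a sequence of points of Baire space. -/
def tuple (s : ℕ → ℕ → ℕ) : ℕ → ℕ := fun n => s n.unpair.1 n.unpair.2

theorem row_tuple (s : ℕ → ℕ → ℕ) (i : ℕ) : row (tuple s) i = s i := by
  funext j
  simp [row, tuple]

/-- The jump `δ' = δ ∘ lim`: a name of `x` is (the code of) a sequence of points of Baire space
that converges to a `δ`-name of `x`. -/
def jump (δ : Representation X) : Representation X where
  names p x := ∃ q, Tendsto (row p) atTop (𝓝 q) ∧ δ.names q x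
  unique := by
    rintro p x y ⟨q, hq, hx⟩ ⟨r, hr, hy⟩
    obtain rfl := tendsto_nhds_unique hq hr
    exact δ.unique _ _ _ hx hy
  surj x := by
    obtain ⟨q, hq⟩ := δ.surj x
    refine ⟨tuple fun _ => q, q, ?_, hq⟩
    have : row (tuple fun _ => q) = fun _ => q := by
      funext i
      exact row_tuple _ i
    rw [this]
    exact tendsto_const_nhds

/-- The representation `δ^ℕ` of the space of sequences. -/
def seq (δ : Representation X) : Representation (ℕ → X) where
  names p s := ∀ i, δ.names (row p i) (s i)
  unique p s t hs ht := funext fun i => δ.unique _ _ _ (hs i) (ht i)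
  surj s := by
    choose f hf using fun i => δ.surj (s i)
    exact ⟨tuple f, fun i => by rw [row_tuple]; exact hf i⟩

/-- `δ ≤ ε`: the identity from `(X, δ)` to `(X, ε)` is computable, that is, it has a computable
realizer. -/
def Reducible (δ ε : Representation X) : Prop :=
  ∃ F : (ℕ → ℕ) →. (ℕ → ℕ), ComputableFun F ∧
    ∀ p x, δ.names p x → ∃ q ∈ F p, ε.names q x

end Representation

/-! ### Multi-valued functions on represented spaces and Weihrauch reducibility -/

/-- A partial multi-valued function on represented spaces. -/
structure Problem (X Y : Type*) where
  inRep : Representation X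
  outRep : Representation Y
  dom : Set X
  val : X → Set Y
  nonempty : ∀ x ∈ dom, (val x).Nonempty

namespace Problem

variable {X Y Z W : Type*}

/-- The jump of a problem: the input representation is replaced by its jump. -/
def jump (f : Problem X Y) : Problem X Y := { f with inRep := f.inRep.jump }

/-- `F` is a realizer of `f`. -/
def RealizedBy (f : Problem X Y) (F : (ℕ → ℕ) →. (ℕ → ℕ)) : Prop :=
  ∀ p x, f.inRep.names p x → x ∈ f.dom →
    ∃ q ∈ F p, ∃ y, f.outRep.names q y ∧ y ∈ f.val x

/-- Strong Weihrauch reducibility: there are computable `K, H` such that `H ∘ G ∘ K` realizes `f`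
whenever `G` realizes `g`. -/
def StrongReducible (f : Problem X Y) (g : Problem Z W) : Prop :=
  ∃ K H : (ℕ → ℕ) →. (ℕ → ℕ), ComputableFun K ∧ ComputableFun H ∧
    ∀ G : (ℕ → ℕ) →. (ℕ → ℕ), g.RealizedBy G → f.RealizedBy (H.comp (G.comp K))

/-- Strong Weihrauch equivalence. -/
def StrongEquiv (f : Problem X Y) (g : Problem Z W) : Prop :=
  f.StrongReducible g ∧ g.StrongReducible f

end Problem

/-! ### Computable metric spaces -/

/-- A standard enumeration of the rational numbers: `⟨⟨a, b⟩, c⟩ ↦ (a - b) / (c + 1)`. -/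
def ratOf (k : ℕ) : ℚ :=
  ((k.unpair.1.unpair.1 : ℚ) - k.unpair.1.unpair.2) / (k.unpair.2 + 1)

theorem ratOf_surjective : Function.Surjective ratOf := by
  intro q
  refine ⟨Nat.pair (Nat.pair q.num.toNat (-q.num).toNat) (q.den - 1), ?_⟩
  have h1 : ((q.num.toNat : ℚ) - ((-q.num).toNat : ℚ)) = q.num := by
    exact_mod_cast Int.toNat_sub_toNat_neg q.num
  have h2 : ((q.den - 1 : ℕ) : ℚ) + 1 = q.den := by
    exact_mod_cast Nat.sub_add_cancel q.den_pos
  simp only [ratOf, Nat.unpair_pair, h1, h2]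
  exact Rat.num_div_den q

/-- The structure of a computable metric space on a metric space `X`: a dense sequence `α` on
which the distance is computable as a function into the reals. -/
structure ComputableMetricSpace (X : Type*) [MetricSpace X] where
  α : ℕ → X
  dense : DenseRange α
  computable_dist : ∃ f : ℕ × ℕ × ℕ → ℕ, Computable f ∧
    ∀ m n k, |dist (α m) (α n) - (ratOf (f (m, n, k)) : ℝ)| ≤ (1 / 2) ^ k

namespace ComputableMetricSpace

variable {X : Type*} [MetricSpace X] (C : ComputableMetricSpace X)

/-- The standard enumeration of the rational open balls: `B_⟨n, k⟩` has centre `α n` and radius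
the `k`-th rational number (so that the empty ball occurs). -/
def ball (i : ℕ) : Set X := Metric.ball (C.α i.unpair.1) (ratOf i.unpair.2 : ℝ)

theorem exists_ball {U : Set X} (hU : IsOpen U) {x : X} (hx : x ∈ U) :
    ∃ i, x ∈ C.ball i ∧ C.ball i ⊆ U := by
  obtain ⟨ε, hε, hεU⟩ := Metric.isOpen_iff.1 hU x hx
  obtain ⟨q, hq0, hq⟩ := exists_rat_btwn (half_pos hε)
  obtain ⟨n, hn⟩ := C.dense.exists_dist_lt x (ε := (q : ℝ)) (by exact_mod_cast hq0)
  obtain ⟨k, rfl⟩ := ratOf_surjective q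
  refine ⟨Nat.pair n k, ?_, ?_⟩
  · simpa [ball] using hn
  · intro y hy
    simp only [ball, Nat.unpair_pair, Metric.mem_ball] at hy
    apply hεU
    rw [Metric.mem_ball]
    have := dist_triangle y (C.α n) x
    rw [dist_comm (C.α n) x] at this
    linarith

theorem exists_ball_empty : ∃ i, C.ball i = ∅ := by
  obtain ⟨k, hk⟩ := ratOf_surjective 0
  exact ⟨Nat.pair 0 k, by simp [ball, hk]⟩

/-- The Cauchy representation: names of `x` are the (indices of) rapidly converging sequences with
limit `x`. -/
def cauchy : Representation X where
  names p x := (∀ k n, k ≤ n → dist (C.α (p n)) (C.α (p k)) < (1 / 2) ^ k) ∧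
    Tendsto (fun n => C.α (p n)) atTop (𝓝 x)
  unique p x y hx hy := tendsto_nhds_unique hx.2 hy.2
  surj x := by
    choose p hp using fun n : ℕ =>
      C.dense.exists_dist_lt x (ε := (1 / 2 : ℝ) ^ (n + 1)) (by positivity)
    refine ⟨p, fun k n hkn => ?_, ?_⟩
    · have h1 := hp n
      have h2 := hp k
      have h3 := dist_triangle_left (C.α (p n)) (C.α (p k)) x
      have h4 : (1 / 2 : ℝ) ^ (n + 1) ≤ (1 / 2) ^ (k + 1) :=
        pow_le_pow_of_le_one (by norm_num) (by norm_num) (by omega)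
      have h5 : (1 / 2 : ℝ) ^ (k + 1) = (1 / 2) ^ k / 2 := by ring
      linarith
    · rw [tendsto_iff_dist_tendsto_zero]
      refine squeeze_zero (fun _ => dist_nonneg) (fun n => ?_)
        ((tendsto_add_atTop_iff_nat 1).2 (tendsto_pow_atTop_nhds_zero_of_lt_one
          (r := (1 / 2 : ℝ)) (by norm_num) (by norm_num)))
      rw [dist_comm]
      exact (hp n).le

/-- The Cauchy representation of `X ⊔ {∞}`, where `∞ = none` has index `0`, the point `α n` has
index `n + 1`, and `∞` has distance `1` from all points of `X`; by the strict inequality at `k = 0`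
in the definition of the Cauchy representation a name is either constantly `∞` or a Cauchy name of
a point of `X`. -/
def cauchyInfty : Representation (Option X) where
  names p o := match o with
    | none => ∀ n, p n = 0
    | some x => ∃ q : ℕ → ℕ, (∀ n, p n = q n + 1) ∧ C.cauchy.names q x
  unique := by
    rintro p (_ | x) (_ | y)
    · intros
      rfl
    · rintro h ⟨q, hq, -⟩
      have := hq 0
      simp [h 0] at this
    · rintro ⟨q, hq, -⟩ h
      have := hq 0
      simp [h 0] at this
    · rintro ⟨q, hq, hx⟩ ⟨r, hr, hy⟩
      have : q = r := funext fun n => Nat.succ_injective ((hq n).symm.trans (hr n))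
      subst this
      rw [C.cauchy.unique _ _ _ hx hy]
  surj := by
    rintro (_ | x)
    · exact ⟨fun _ => 0, fun _ => rfl⟩
    · obtain ⟨q, hq⟩ := C.cauchy.surj x
      exact ⟨fun n => q n + 1, q, fun _ => rfl, hq⟩

/-- The negative representation `ψ₋` of the closed subsets of `X`: a name enumerates rational open
balls that exhaust the complement. -/
def psiNeg : Representation (Closeds X) where
  names p A := (A : Set X) = (⋃ i, C.ball (p i))ᶜ
  unique p A B hA hB := SetLike.coe_injective (hA.trans hB.symm)
  surj A := by
    classical
    obtain ⟨e, he⟩ := C.exists_ball_empty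
    refine ⟨fun i => if C.ball i ⊆ (A : Set X)ᶜ then i else e, ?_⟩
    ext x
    simp only [mem_compl_iff, mem_iUnion, not_exists]
    constructor
    · intro hx i hi
      split_ifs at hi with h
      · exact h hi hx
      · simp [he] at hi
    · intro h
      by_contra hx
      obtain ⟨i, hi, hiA⟩ := C.exists_ball A.isClosed.isOpen_compl hx
      apply h i
      rw [if_pos hiA]
      exact hi

/-- The positive representation `ψ₊` of the closed subsets of `X`: a name describes a sequence in
`X ⊔ {∞}` whose members in `X` are dense in the set (the point `∞` is isolated, so it does not
matter in which of the two spaces the closure is taken). -/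
def psiPos : Representation (Closeds X) where
  names p A := ∃ s : ℕ → Option X, C.cauchyInfty.seq.names p s ∧
    (A : Set X) = closure {x | ∃ n, s n = some x}
  unique := by
    rintro p A B ⟨s, hs, hA⟩ ⟨t, ht, hB⟩
    obtain rfl := C.cauchyInfty.seq.unique _ _ _ hs ht
    exact SetLike.coe_injective (hA.trans hB.symm)
  surj A := by
    suffices h : ∃ s : ℕ → Option X, (A : Set X) = closure {x | ∃ n, s n = some x} by
      obtain ⟨s, hs⟩ := h
      obtain ⟨p, hp⟩ := C.cauchyInfty.seq.surj s
      exact ⟨p, s, hp, hs⟩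
    rcases (A : Set X).eq_empty_or_nonempty with h | h
    · exact ⟨fun _ => none, by simp [h]⟩
    · have : SeparableSpace X := ⟨range C.α, countable_range _, C.dense⟩
      have : SecondCountableTopology X := UniformSpace.secondCountable_of_separable X
      have : Nonempty (A : Set X) := h.to_subtype
      refine ⟨fun n => some (denseSeq (A : Set X) n : X), ?_⟩
      have h1 : {x : X | ∃ n, some (denseSeq (A : Set X) n : X) = some x} =
          Subtype.val '' range (denseSeq (A : Set X)) := by
        ext x
        simp
      rw [h1]
      have h2 := (denseRange_denseSeq (A : Set X)).closure_eq
      apply Subset.antisymm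
      · intro x hx
        have h3 : (⟨x, hx⟩ : (A : Set X)) ∈ closure (range (denseSeq (A : Set X))) := by
          rw [h2]
          trivial
        exact closure_subtype.1 h3
      · apply closure_minimal _ A.isClosed
        rintro _ ⟨y, -, rfl⟩
        exact y.2

variable [CompleteSpace X]

/-- The Baire category problem on a computable Polish space, relative to a representation `ψ` of
the closed sets: given closed sets `A_i` with empty interior, find a point outside of all of
them. -/
def category (ψ : Representation (Closeds X)) : Problem (ℕ → Closeds X) X where
  inRep := ψ.seq
  outRep := C.cauchy
  dom := {A | ∀ i, interior (A i : Set X) = ∅}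
  val A := (⋃ i, (A i : Set X))ᶜ
  nonempty A hA := by
    have : Nonempty X := ⟨C.α 0⟩
    have h := dense_iInter_of_isOpen_nat (f := fun i => (A i : Set X)ᶜ)
      (fun i => (A i).isClosed.isOpen_compl) (fun i => interior_eq_empty_iff_dense_compl.1 (hA i))
    rw [compl_iUnion]
    exact h.nonempty

/-- `BCT₀`: the Baire category problem with closed sets given negatively. -/
def BCT0 : Problem (ℕ → Closeds X) X := C.category C.psiNeg

/-- `BCT₂`: the Baire category problem with closed sets given positively. -/
def BCT2 : Problem (ℕ → Closeds X) X := C.category C.psiPos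

end ComputableMetricSpace

/-! ### Binary words and Cantor space -/

/-- The set of finite binary words. -/
def Word : Type := List Bool

instance : DecidableEq Word := inferInstanceAs (DecidableEq (List Bool))

instance : Primcodable Word := inferInstanceAs (Primcodable (List Bool))

/-- The discrete metric on words. -/
noncomputable instance : MetricSpace Word where
  dist v w := if v = w then 0 else 1
  dist_self v := if_pos rfl
  dist_comm v w := by simp only [eq_comm]
  dist_triangle u v w := by
    by_cases h1 : u = v <;> by_cases h2 : v = w <;> by_cases h3 : u = w <;> simp_all
  eq_of_dist_eq_zero {v w} h := by
    by_contra hne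
    exact one_ne_zero ((if_neg hne).symm.trans h)

theorem Word.dist_def (v w : Word) : dist v w = if v = w then 0 else 1 := rfl

/-- The standard enumeration of all binary words. -/
def Word.ofNat (n : ℕ) : Word := (Encodable.decode (α := Word) n).getD List.nil

/-- The words with the discrete metric form a computable metric space. -/
noncomputable def wordSpace : ComputableMetricSpace Word where
  α := Word.ofNat
  dense := by
    apply Function.Surjective.denseRange
    intro w
    refine ⟨Encodable.encode w, ?_⟩
    rw [Word.ofNat, Encodable.encodek]
    rfl
  computable_dist := by
    refine ⟨fun a => if Word.ofNat a.1 = Word.ofNat a.2.1 then 0 else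
      Nat.pair (Nat.pair 1 0) 0, ?_, ?_⟩
    · apply Primrec.to_comp
      have h : Primrec Word.ofNat :=
        Primrec.option_getD.comp Primrec.decode (Primrec.const _)
      exact Primrec.ite (PrimrecRel.comp Primrec.eq (h.comp Primrec.fst)
        (h.comp (Primrec.fst.comp Primrec.snd))) (Primrec.const _) (Primrec.const _)
    · intro m n k
      rw [Word.dist_def]
      dsimp only
      split_ifs <;> simp [ratOf]

/-- Cantor space, the space of infinite binary sequences. -/
def Cantor : Type := ℕ → Bool

/-- The metric `d(x, y) = 2 ^ (-n)`, where `n` is the first position at which `x` and `y` differ; it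
induces the product topology. -/
noncomputable instance : MetricSpace Cantor := PiNat.metricSpace (E := fun _ : ℕ => Bool)

instance : CompleteSpace Cantor := PiNat.completeSpace (E := fun _ : ℕ => Bool)

/-- The basic open set `w 2^ℕ` of all infinite binary sequences that extend the word `w`. -/
def cyl (w : Word) : Set Cantor :=
  {x | ∀ i (h : i < List.length w), x i = List.get w ⟨i, h⟩}

theorem primrec_two_pow : Primrec fun j : ℕ => 2 ^ j := by
  refine (Primrec.nat_rec₁ 1 (Primrec.nat_mul.comp Primrec.snd (Primrec.const 2)).to₂).of_eq ?_
  intro n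
  induction n with
  | zero => rfl
  | succ n ih => simp only [ih, pow_succ]

theorem primrec_testBit : Primrec₂ Nat.testBit := by
  have h : Primrec fun a : ℕ × ℕ => a.1 / 2 ^ a.2 % 2 :=
    Primrec.nat_mod.comp (Primrec.nat_div.comp Primrec.fst (primrec_two_pow.comp Primrec.snd))
      (Primrec.const 2)
  refine (PrimrecRel.comp Primrec.eq h (Primrec.const 1)).decide.of_eq fun a => ?_
  rw [Nat.testBit_eq_decide_div_mod_eq]

/-- The eventually vanishing binary sequences, enumerated through binary expansions. -/
def Cantor.ofNat (n : ℕ) : Cantor := fun i => n.testBit i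

theorem Cantor.ofNat_injective : Function.Injective Cantor.ofNat :=
  fun _ _ h => Nat.eq_of_testBit_eq fun i => congrFun h i

theorem Cantor.dist_eq {x y : Cantor} {j : ℕ} (hj : x j ≠ y j) (h : ∀ i < j, x i = y i) :
    dist x y = (1 / 2) ^ j := by
  have hne : x ≠ y := fun e => hj (congrFun e j)
  have h1 : PiNat.firstDiff (E := fun _ : ℕ => Bool) x y = j := by
    apply le_antisymm
    · by_contra hlt
      exact hj (PiNat.apply_eq_of_lt_firstDiff (E := fun _ : ℕ => Bool) (not_le.1 hlt))
    · by_contra hlt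
      exact PiNat.apply_firstDiff_ne (E := fun _ : ℕ => Bool) hne (h _ (not_le.1 hlt))
  rw [← h1]
  exact PiNat.dist_eq_of_ne (E := fun _ : ℕ => Bool) hne

/-- Cantor space as a computable metric space. -/
noncomputable def cantorSpace : ComputableMetricSpace Cantor where
  α := Cantor.ofNat
  dense := by
    rw [Metric.denseRange_iff]
    intro x ε hε
    obtain ⟨N, hN⟩ := exists_pow_lt_of_lt_one hε (by norm_num : (1 / 2 : ℝ) < 1)
    refine ⟨Nat.ofBits fun i : Fin N => x i, lt_of_le_of_lt ?_ hN⟩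
    refine (PiNat.mem_cylinder_iff_dist_le (E := fun _ : ℕ => Bool)).1 fun i hi => ?_
    exact (Nat.testBit_ofBits_lt (fun i : Fin N => x i) i hi).symm
  computable_dist := by
    let fd : ℕ × ℕ → ℕ := fun a =>
      (List.range (a.1 + a.2)).findIdx fun j => !(a.1.testBit j == a.2.testBit j)
    have hfd : Primrec fd := by
      refine Primrec.list_findIdx (Primrec.list_range.comp
        (Primrec.nat_add.comp Primrec.fst Primrec.snd)) (Primrec.not.comp (Primrec.beq.comp
          (primrec_testBit.comp (Primrec.fst.comp Primrec.fst) Primrec.snd)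
          (primrec_testBit.comp (Primrec.snd.comp Primrec.fst) Primrec.snd))).to₂
    refine ⟨fun a => if a.1 = a.2.1 then 0 else
      Nat.pair (Nat.pair 1 0) (2 ^ fd (a.1, a.2.1) - 1), ?_, ?_⟩
    · apply Primrec.to_comp
      refine Primrec.ite (PrimrecRel.comp Primrec.eq Primrec.fst (Primrec.fst.comp Primrec.snd))
        (Primrec.const _) (Primrec₂.natPair.comp (Primrec.const _) (Primrec.nat_sub.comp
          (primrec_two_pow.comp (hfd.comp (Primrec.pair Primrec.fst
            (Primrec.fst.comp Primrec.snd)))) (Primrec.const 1)))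
    · intro m n k
      dsimp only
      split_ifs with h
      · simp [h, ratOf]
      · have hlt : fd (m, n) < (List.range (m + n)).length := by
          apply List.findIdx_lt_length_of_exists
          by_contra hall
          push Not at hall
          apply h
          apply Nat.eq_of_testBit_eq
          intro j
          by_cases hj : j < m + n
          · have := hall j (List.mem_range.2 hj)
            simpa using this
          · have h2 : j < 2 ^ j := Nat.lt_two_pow_self
            rw [Nat.testBit_lt_two_pow (by omega), Nat.testBit_lt_two_pow (by omega)]
        have hd : dist (Cantor.ofNat m) (Cantor.ofNat n) = (1 / 2) ^ fd (m, n) := by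
          apply Cantor.dist_eq
          · have := List.findIdx_getElem (w := hlt)
            simpa [fd, Cantor.ofNat] using this
          · intro i hi
            have := List.not_of_lt_findIdx hi
            simpa [Cantor.ofNat] using this
        rw [hd]
        simp [ratOf]

/-- The representation `ψ_#` of the closed subsets of Cantor space: a name is a negative name of a
set `E` of words, and it represents the complement of the union of all `w 2^ℕ` with `w ∈ E`. -/
noncomputable def psiSharp : Representation (Closeds Cantor) where
  names p A := ∃ E : Closeds Word, wordSpace.psiNeg.names p E ∧
    (A : Set Cantor) = (⋃ w ∈ E, cyl w)ᶜ
  unique := by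
    rintro p A B ⟨D, hD, hA⟩ ⟨E, hE, hB⟩
    obtain rfl := wordSpace.psiNeg.unique _ _ _ hD hE
    exact SetLike.coe_injective (hA.trans hB.symm)
  surj A := by
    have hdisc : ∀ s : Set Word, IsOpen s := fun s => by
      refine Metric.isOpen_iff.2 fun w hw => ⟨1, one_pos, fun v hv => ?_⟩
      rw [Metric.mem_ball, Word.dist_def] at hv
      split_ifs at hv with h
      · exact h ▸ hw
      · exact absurd hv (lt_irrefl _)
    let E : Closeds Word := ⟨{w | Disjoint (cyl w) (A : Set Cantor)}, ⟨hdisc _⟩⟩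
    obtain ⟨p, hp⟩ := wordSpace.psiNeg.surj E
    refine ⟨p, E, hp, ?_⟩
    ext x
    simp only [mem_compl_iff, mem_iUnion, not_exists]
    constructor
    · intro hx w hw hxw
      exact Set.disjoint_left.1 hw hxw hx
    · intro h
      by_contra hx
      obtain ⟨ε, hε, hεA⟩ := Metric.isOpen_iff.1 A.isClosed.isOpen_compl x hx
      obtain ⟨N, hN⟩ := exists_pow_lt_of_lt_one hε (by norm_num : (1 / 2 : ℝ) < 1)
      let l : List Bool := List.ofFn fun i : Fin N => (x i : Bool)
      have hl : l.length = N := List.length_ofFn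
      have hlx : ∀ i (h : i < l.length), l.get ⟨i, h⟩ = x i := fun i h => List.getElem_ofFn h
      let w : Word := l
      have hw : ∀ y ∈ cyl w, ∀ i < N, y i = x i := fun y hy i hi =>
        (hy i (hl ▸ hi)).trans (hlx i _)
      have hxw : x ∈ cyl w := fun i hi => (hlx i hi).symm
      refine h w (Set.disjoint_left.2 fun y hy => hεA ?_) hxw
      refine lt_of_le_of_lt ?_ hN
      exact (PiNat.mem_cylinder_iff_dist_le (E := fun _ : ℕ => Bool)).1 (hw y hy)

/-- `Π⁰₁G`: the Baire category problem on Cantor space with closed sets given with respect to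
`ψ_#`. -/
noncomputable def Pi01G : Problem (ℕ → Closeds Cantor) Cantor := cantorSpace.category psiSharp

end CompAnalysis

open CompAnalysis

/-!
The equivalences follow from the reductions `Pi01G ≤ BCT0' ≤ BCT2 ≤ BCT0' ≤ Pi01G`. Two tools are
common to all of them.

* Uniformly semidecidable predicates (`Semi`) of a name. They are closed under the usual operations,
  have computable choice functions (`Semi.exists_choice`), and their complements can be enumerated
  in the limit (`Semi.exists_limit`): a listed item is erased as soon as it is rejected. So to name a
  closed set in the limit it suffices to describe its complement by balls such that the rejected
  balls can be semidecided (`ComputableMetricSpace.exists_limit_name_seq`).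
* Conversely, the entries of a limit can be guessed such that wrong guesses are refuted at a finite
  stage (`Refuted`, `guess`). If the objects to be listed are indexed by guesses, then those with a
  refuted guess can be rejected.

On Cantor space the length of a word can serve as the guess: a `ψ_-'`-name becomes a `ψ_#`-name by
putting a word into the set if the guess given by its length is correct and the cylinder is inside of
the guessed ball. The converse direction is the enumeration in the limit.

`BCT2 ≤ BCT0'`: the complement of a positively given set is the union of the balls that are never
seen to meet it. `BCT0' ≤ BCT2`: a nowhere dense set in a perfect space is enlarged to a positively
given one, by listing for each ball one point that is not seen to be in the complement guessed so
far. Every point of the set is a limit of listed points, while outside of the set the listed points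
are locally finite, hence, as there are no isolated points, the enlarged set is nowhere dense.

`BCT0' ≤ Pi01G`: bit sequences are read as sequences of shrinking balls, where the numbers of zeros
code the balls and the ones are separators (`ballStep`). The words whose current ball is inside of a
correctly guessed ball of the complement generate a dense open set. As the current ball does not
change while zeros are read, any word can be prolonged to a length that is a correct guess.

`Pi01G ≤ BCT0'`: one needs a computable scheme of nonempty open cells indexed by binary words, such
that cells of different words of the same length are disjoint, the cells of each length cover the
dense sequence, and every nonempty open set contains a cell. The cells are obtained by splitting
along spheres around points of the dense sequence. A diagonalization yields a computable number whose
quotients by powers of two all avoid the distances of points of the dense sequence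
(`dist_mul_ne_baseRadius`); with such radii each of these points is strictly on one side of each
sphere. A dense open set of Cantor space then corresponds to a dense open union of cells, and a point
that is in cells of all lengths computes the bit sequence of its cells (`exists_itinerary`).
-/

namespace CompAnalysis

open CompAnalysis.Representation

/-! ### Computability of basic operations, set up for `fun_prop` -/

attribute [fun_prop] Computable
attribute [fun_prop] Computable.id Computable.const Computable.comp Computable.pair

section Computability

variable {α β γ σ : Type*} [Primcodable α] [Primcodable β] [Primcodable γ] [Primcodable σ]

@[fun_prop]
theorem computable_fst {f : α → β × γ} (hf : Computable f) : Computable fun a => (f a).1 :=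
  Computable.fst.comp hf

@[fun_prop]
theorem computable_snd {f : α → β × γ} (hf : Computable f) : Computable fun a => (f a).2 :=
  Computable.snd.comp hf

@[fun_prop]
theorem computable_add {f g : α → ℕ} (hf : Computable f) (hg : Computable g) :
    Computable fun a => f a + g a :=
  Primrec.nat_add.to_comp.comp hf hg

@[fun_prop]
theorem computable_mul {f g : α → ℕ} (hf : Computable f) (hg : Computable g) :
    Computable fun a => f a * g a :=
  Primrec.nat_mul.to_comp.comp hf hg

@[fun_prop]
theorem computable_sub {f g : α → ℕ} (hf : Computable f) (hg : Computable g) :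
    Computable fun a => f a - g a :=
  Primrec.nat_sub.to_comp.comp hf hg

@[fun_prop]
theorem computable_div {f g : α → ℕ} (hf : Computable f) (hg : Computable g) :
    Computable fun a => f a / g a :=
  Primrec.nat_div.to_comp.comp hf hg

@[fun_prop]
theorem computable_two_pow {f : α → ℕ} (hf : Computable f) : Computable fun a => 2 ^ f a :=
  primrec_two_pow.to_comp.comp hf

@[fun_prop]
theorem computable_testBit {f g : α → ℕ} (hf : Computable f) (hg : Computable g) :
    Computable fun a => (f a).testBit (g a) :=
  primrec_testBit.to_comp.comp hf hg

@[fun_prop]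
theorem computable_natPair {f g : α → ℕ} (hf : Computable f) (hg : Computable g) :
    Computable fun a => Nat.pair (f a) (g a) :=
  Primrec₂.natPair.to_comp.comp hf hg

@[fun_prop]
theorem computable_natUnpair {f : α → ℕ} (hf : Computable f) :
    Computable fun a => Nat.unpair (f a) :=
  Computable.unpair.comp hf

@[fun_prop]
theorem computable_decide_lt {f g : α → ℕ} (hf : Computable f) (hg : Computable g) :
    Computable fun a => decide (f a < g a) :=
  Primrec.nat_lt.decide.to_comp.comp hf hg

@[fun_prop]
theorem computable_beq {f g : α → ℕ} (hf : Computable f) (hg : Computable g) :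
    Computable fun a => f a == g a :=
  Primrec.beq.to_comp.comp hf hg

@[fun_prop]
theorem computable_not {f : α → Bool} (hf : Computable f) : Computable fun a => !f a :=
  Primrec.not.to_comp.comp hf

@[fun_prop]
theorem computable_and {f g : α → Bool} (hf : Computable f) (hg : Computable g) :
    Computable fun a => f a && g a :=
  Primrec.and.to_comp.comp hf hg

@[fun_prop]
theorem computable_or {f g : α → Bool} (hf : Computable f) (hg : Computable g) :
    Computable fun a => f a || g a :=
  Primrec.or.to_comp.comp hf hg

@[fun_prop]
theorem computable_ite {c : α → Bool} {f g : α → σ} (hc : Computable c) (hf : Computable f)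
    (hg : Computable g) : Computable fun a => if c a = true then f a else g a :=
  (Computable.cond hc hf hg).of_eq fun a => by cases c a <;> rfl

@[fun_prop]
theorem computable_length {f : α → List β} (hf : Computable f) :
    Computable fun a => (f a).length :=
  Computable.list_length.comp hf

@[fun_prop]
theorem computable_getD {f : α → List β} {g : α → ℕ} (d : β) (hf : Computable f)
    (hg : Computable g) : Computable fun a => (f a).getD (g a) d :=
  (Primrec.list_getD d).to_comp.comp hf hg

@[fun_prop]
theorem computable_take {f : α → List β} {g : α → ℕ} (hf : Computable f) (hg : Computable g) :
    Computable fun a => (f a).take (g a) :=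
  Primrec.list_take.to_comp.comp hg hf

@[fun_prop]
theorem computable_append {f g : α → List β} (hf : Computable f) (hg : Computable g) :
    Computable fun a => f a ++ g a :=
  Computable.list_append.comp hf hg

@[fun_prop]
theorem computable_cons {f : α → β} {g : α → List β} (hf : Computable f) (hg : Computable g) :
    Computable fun a => f a :: g a :=
  Computable.list_cons.comp hf hg

@[fun_prop]
theorem computable_range {f : α → ℕ} (hf : Computable f) :
    Computable fun a => List.range (f a) :=
  Primrec.list_range.to_comp.comp hf

/-- Folding a list is computable for a computable step function; Mathlib has this only for
primitive recursive functions. -/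
@[fun_prop]
theorem computable_foldl {l : α → List β} {i : α → σ} {f : α → σ → β → σ} (hl : Computable l)
    (hi : Computable i) (hf : Computable fun x : α × σ × β => f x.1 x.2.1 x.2.2) :
    Computable fun a => (l a).foldl (f a) (i a) := by
  have h1 : Computable₂ fun (a : α) (x : ℕ × σ) =>
      Option.casesOn (motive := fun _ => σ) ((l a)[x.1]?) x.2 (f a x.2) := by
    refine Computable.option_casesOn (o := fun y : α × ℕ × σ => (l y.1)[y.2.1]?)
      (f := fun y : α × ℕ × σ => y.2.2) (g := fun y b => f y.1 y.2.2 b)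
      (Computable.list_getElem?.comp (hl.comp Computable.fst) (by fun_prop)) (by fun_prop) ?_
    exact hf.comp (f := fun x : α × σ × β => f x.1 x.2.1 x.2.2)
      (g := fun z : (α × ℕ × σ) × β => (z.1.1, z.1.2.2, z.2)) (by fun_prop)
  refine (Computable.nat_rec (computable_length hl) hi h1).of_eq fun a => ?_
  have h2 : ∀ k ≤ (l a).length, (Nat.rec (motive := fun _ => σ) (i a) (fun n s =>
      Option.casesOn (motive := fun _ => σ) ((l a)[n]?) s (f a s)) k : σ) =
      ((l a).take k).foldl (f a) (i a) := by
    intro k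
    induction k with
    | zero => intro _; simp
    | succ k ih =>
      intro hk
      have hk' : k < (l a).length := hk
      simp only [ih hk'.le]
      rw [List.take_add_one, List.getElem?_eq_getElem hk', List.foldl_append]
      simp
  simpa using h2 _ le_rfl

@[fun_prop]
theorem computable_map_range {n : α → ℕ} {f : α → ℕ → β} (hn : Computable n)
    (hf : Computable fun x : α × ℕ => f x.1 x.2) :
    Computable fun a => (List.range (n a)).map (f a) := by
  have : Computable fun a => (List.range (n a)).foldl (fun l k => l ++ [f a k]) [] := by fun_prop
  refine this.of_eq fun a => ?_
  induction n a with
  | zero => rfl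
  | succ k ih => rw [List.range_succ, List.foldl_append, ih]; simp

@[fun_prop]
theorem computable_all {l : α → List β} {f : α → β → Bool} (hl : Computable l)
    (hf : Computable fun x : α × β => f x.1 x.2) : Computable fun a => (l a).all (f a) := by
  have h : Computable fun x : α × Bool × β => x.2.1 && f x.1 x.2.2 :=
    computable_and (by fun_prop) (hf.comp (f := fun x : α × β => f x.1 x.2)
      (g := fun x : α × Bool × β => (x.1, x.2.2)) (by fun_prop))
  refine (computable_foldl (f := fun a b c => b && f a c) hl (Computable.const true) h).of_eq
    fun a => ?_
  induction l a using List.reverseRecOn with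
  | nil => rfl
  | append_singleton l b ih => rw [List.foldl_append, ih]; simp

@[fun_prop]
theorem computable_any {l : α → List β} {f : α → β → Bool} (hl : Computable l)
    (hf : Computable fun x : α × β => f x.1 x.2) : Computable fun a => (l a).any (f a) := by
  have : Computable fun a => !(l a).all fun k => !f a k := by fun_prop
  exact this.of_eq fun a => by rw [Bool.eq_iff_iff]; simp

/-- The least `i < n` with `f i`, and `n` if there is none. -/
def firstBelow (f : ℕ → Bool) (n : ℕ) : ℕ := (List.range n).findIdx f

theorem firstBelow_le (f : ℕ → Bool) (n : ℕ) : firstBelow f n ≤ n := by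
  simpa [firstBelow] using List.findIdx_le_length (xs := List.range n) (p := f)

theorem le_firstBelow_iff {f : ℕ → Bool} {n k : ℕ} :
    k ≤ firstBelow f n ↔ k ≤ n ∧ ∀ i < k, f i = false := by
  constructor
  · intro h
    have hn := h.trans (firstBelow_le f n)
    refine ⟨hn, fun i hi => ?_⟩
    have := List.not_of_lt_findIdx (lt_of_lt_of_le hi h : i < (List.range n).findIdx f)
    simpa using this
  · rintro ⟨hn, h⟩
    by_contra hlt
    have hlt' : (List.range n).findIdx f < k := not_le.1 hlt
    have h1 : (List.range n).findIdx f < (List.range n).length := by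
      rw [List.length_range]; omega
    have h2 := List.findIdx_getElem (w := h1)
    simp [h _ hlt'] at h2

theorem firstBelow_eq_find {f : ℕ → Bool} {n : ℕ} (h : ∃ i, f i = true) (hn : Nat.find h < n) :
    firstBelow f n = Nat.find h := by
  apply le_antisymm
  · by_contra hlt
    have := (le_firstBelow_iff.1 (not_le.1 hlt : Nat.find h + 1 ≤ _)).2 _ (Nat.lt_succ_self _)
    simp [Nat.find_spec h] at this
  · exact le_firstBelow_iff.2 ⟨hn.le, fun i hi => by simpa using Nat.find_min h hi⟩

@[fun_prop]
theorem computable_firstBelow {n : α → ℕ} {f : α → ℕ → Bool} (hn : Computable n)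
    (hf : Computable fun x : α × ℕ => f x.1 x.2) :
    Computable fun a => firstBelow (f a) (n a) := by
  have : Computable fun a => (List.range (n a)).foldl
      (fun b k => if (decide (b < k) || f a k) = true then b else k + 1) 0 := by fun_prop
  refine this.of_eq fun a => ?_
  induction n a with
  | zero => rfl
  | succ k ih =>
    rw [List.range_succ, List.foldl_append, ih]
    have h1 := firstBelow_le (f a) k
    have h2 := (le_firstBelow_iff (f := f a) (n := k)).1 le_rfl
    simp only [List.foldl_cons, List.foldl_nil]
    split_ifs with h
    · apply le_antisymm
      · exact le_firstBelow_iff.2 ⟨h1.trans k.le_succ, h2.2⟩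
      · by_contra hlt
        have h3 := le_firstBelow_iff.1 (not_le.1 hlt : firstBelow (f a) k + 1 ≤ _)
        have h4 := h3.2 _ (Nat.lt_succ_self _)
        rcases h1.lt_or_eq with h5 | h5
        · have h6 : firstBelow (f a) k + 1 ≤ firstBelow (f a) k :=
            le_firstBelow_iff.2 ⟨h5, h3.2⟩
          omega
        · rw [h5] at h4
          simp [h4, h5] at h
    · have h5 : firstBelow (f a) k = k := by
        by_contra h6
        exact h (by simp [lt_of_le_of_ne h1 h6])
      have h6 : f a k = false := by
        by_contra h7
        exact h (by simp [h7])
      apply le_antisymm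
      · refine le_firstBelow_iff.2 ⟨le_rfl, fun i hi => ?_⟩
        rcases (Nat.lt_succ_iff.1 hi).lt_or_eq with h7 | h7
        · exact h2.2 i (h5.symm ▸ h7)
        · exact h7 ▸ h6
      · exact firstBelow_le _ _

/-- Recursion with an unbounded search in each step is computable, provided that all searches on the
way are successful. -/
theorem computable_search_rec {n : α → ℕ} {S : α → ℕ → σ} {p : α × ℕ × σ → ℕ → Bool}
    {g : α × ℕ × σ → ℕ → σ} (hn : Computable n) (h0 : Computable fun a => S a 0)
    (hp : Computable fun x : (α × ℕ × σ) × ℕ => p x.1 x.2)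
    (hg : Computable fun x : (α × ℕ × σ) × ℕ => g x.1 x.2)
    (hS : ∀ a, ∀ k < n a, ∃ h : ∃ y, p (a, k, S a k) y = true,
      S a (k + 1) = g (a, k, S a k) (Nat.find h)) : Computable fun a => S a (n a) := by
  have h1 : Partrec fun x : α × ℕ × σ => (Nat.rfind fun y => Part.some (p x y)).map (g x) :=
    (Partrec.rfind (p := fun x y => Part.some (p x y)) hp.partrec).map hg
  refine (Partrec.nat_rec hn h0.partrec h1.to₂).of_eq_tot fun a => ?_
  have h2 : ∀ k ≤ n a, (Nat.rec (motive := fun _ => Part σ) (Part.some (S a 0))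
      (fun y IH => IH.bind fun s =>
        (Nat.rfind fun z => Part.some (p (a, y, s) z)).map (g (a, y, s))) k : Part σ) =
      Part.some (S a k) := by
    intro k
    induction k with
    | zero => exact fun _ => rfl
    | succ k ih =>
      intro hk
      obtain ⟨h, hS'⟩ := hS a k hk
      have h3 : (Nat.rfind fun z => Part.some (p (a, k, S a k) z)) = Part.some (Nat.find h) :=
        Part.eq_some_iff.2 (Nat.mem_rfind.2 ⟨Part.mem_some_iff.2 (Nat.find_spec h).symm,
          fun {m} hm => Part.mem_some_iff.2 (by simpa using (Nat.find_min h hm))⟩)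
      simp only [ih (Nat.le_of_succ_le hk), Part.bind_some, h3, Part.map_some, hS']
  exact (Part.eq_some_iff.1 (h2 _ le_rfl))

end Computability

/-! ### Prefixes and computable functions on Baire space -/

@[simp]
theorem length_pref (p : ℕ → ℕ) (n : ℕ) : (pref p n).length = n := by simp [pref]

theorem pref_prefix (p : ℕ → ℕ) {m n : ℕ} (h : m ≤ n) : pref p m <+: pref p n :=
  (List.prefix_iff_eq_take.2 (by simp [List.take_range, h])  : List.range m <+: List.range n).map p

theorem take_pref (p : ℕ → ℕ) {m n : ℕ} (h : m ≤ n) : (pref p n).take m = pref p m := by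
  simpa using (List.prefix_iff_eq_take.1 (pref_prefix p h)).symm

theorem getD_pref (p : ℕ → ℕ) {m n d : ℕ} (h : m < n) : (pref p n).getD m d = p m := by
  simp [pref, List.getD_eq_getElem?_getD, h]

theorem ComputableFun.comp {F G : (ℕ → ℕ) →. (ℕ → ℕ)} (hF : ComputableFun F)
    (hG : ComputableFun G) : ComputableFun (F.comp G) := by
  obtain ⟨φ, hφ, hφm, hφs⟩ := hF
  obtain ⟨χ, hχ, hχm, hχs⟩ := hG
  refine ⟨fun u => φ (χ u), hφ.comp hχ, fun u v h => hφm _ _ (hχm _ _ h), fun p q hq => ?_⟩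
  rw [PFun.comp_apply] at hq
  obtain ⟨r, hr, hq⟩ := Part.mem_bind_iff.1 hq
  obtain ⟨h1, h2⟩ := hχs p r hr
  obtain ⟨h3, h4⟩ := hφs r q hq
  constructor
  · intro m
    obtain ⟨n, hn⟩ := h1 m
    obtain ⟨k, hk⟩ := h3 n
    exact ⟨k, (congrArg φ hn).trans hk⟩
  · intro n
    obtain ⟨m, hm⟩ := h4 n
    obtain ⟨k, hk⟩ := h2 m
    exact ⟨k, hm.trans (hφm _ _ hk)⟩

theorem computableFun_id : ComputableFun (PFun.id _) := by
  refine ⟨id, Computable.id, fun _ _ h => h, fun p q hq => ?_⟩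
  obtain rfl : q = p := by simpa using hq
  exact ⟨fun m => ⟨m, rfl⟩, fun n => ⟨n, List.prefix_rfl⟩⟩

/-! ### Uniformly semidecidable predicates -/

/-- `P p x` is semidecidable uniformly in `p`: it is confirmed by a finite prefix of `p`, and
which prefixes confirm it is decidable and preserved under extensions. -/
def Semi {α : Type*} [Primcodable α] (P : (ℕ → ℕ) → α → Prop) : Prop :=
  ∃ R : List ℕ → α → Bool, (Computable fun x : List ℕ × α => R x.1 x.2) ∧
    (∀ u v x, u <+: v → R u x = true → R v x = true) ∧
    ∀ p x, P p x ↔ ∃ m, R (pref p m) x = true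

namespace Semi

variable {α β : Type*} [Primcodable α] [Primcodable β]

/-- Searching through the prefixes of `p` for one that passes a decidable test. -/
theorem of_pref {T : List ℕ → α → Bool} (hT : Computable fun x : List ℕ × α => T x.1 x.2) :
    Semi fun p x => ∃ m, T (pref p m) x = true := by
  refine ⟨fun u x => (List.range (u.length + 1)).any fun m => T (u.take m) x, by fun_prop, ?_, ?_⟩
  · intro u v x huv h
    obtain ⟨m, hm, h⟩ := List.any_eq_true.1 h
    refine List.any_eq_true.2 ⟨m, ?_, ?_⟩
    · have := huv.length_le
      simp only [List.mem_range] at hm ⊢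
      omega
    · have : v.take m = u.take m := by
        obtain ⟨w, rfl⟩ := huv
        exact List.take_append_of_le_length (Nat.lt_succ_iff.1 (List.mem_range.1 hm))
      rwa [this]
  · intro p x
    constructor
    · rintro ⟨m, hm⟩
      exact ⟨m, List.any_eq_true.2 ⟨m, by simp, by rwa [take_pref p le_rfl]⟩⟩
    · rintro ⟨n, hn⟩
      obtain ⟨m, hm, h⟩ := List.any_eq_true.1 hn
      rw [length_pref, List.mem_range] at hm
      rw [take_pref p (Nat.lt_succ_iff.1 hm)] at h
      exact ⟨m, h⟩

/-- Searching for an entry of `p` (at the position coded by the first component of `k`) that passes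
a decidable test. -/
theorem of_entry {T : ℕ → ℕ → α → Bool}
    (hT : Computable fun x : ℕ × ℕ × α => T x.1 x.2.1 x.2.2) :
    Semi fun p x => ∃ k, T k (p k.unpair.1) x = true := by
  have h : Computable fun x : List ℕ × α => decide (0 < x.1.length) &&
      T (x.1.length - 1) (x.1.getD (x.1.length - 1).unpair.1 0) x.2 :=
    computable_and (by fun_prop) (hT.comp (f := fun x : ℕ × ℕ × α => T x.1 x.2.1 x.2.2)
      (g := fun x : List ℕ × α =>
        (x.1.length - 1, x.1.getD (x.1.length - 1).unpair.1 0, x.2)) (by fun_prop))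
  obtain ⟨R, h1, h2, h3⟩ := of_pref (T := fun u x => decide (0 < u.length) &&
      T (u.length - 1) (u.getD (u.length - 1).unpair.1 0) x) h
  refine ⟨R, h1, h2, fun p x => ?_⟩
  rw [← h3]
  have key : ∀ k, (pref p (k + 1)).getD k.unpair.1 0 = p k.unpair.1 := fun k =>
    getD_pref p (Nat.lt_succ_of_le (Nat.unpair_left_le k))
  constructor
  · rintro ⟨k, hk⟩
    refine ⟨k + 1, ?_⟩
    simp only [length_pref, Nat.add_sub_cancel, key, hk]
    simp
  · rintro ⟨m, hm⟩
    rcases m with _ | k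
    · simp at hm
    · simp only [length_pref, Nat.add_sub_cancel, key, Bool.and_eq_true] at hm
      exact ⟨k, hm.2⟩

theorem of_computable {f : α → Bool} (hf : Computable f) : Semi fun _ x => f x = true :=
  ⟨fun _ x => f x, by fun_prop, fun _ _ _ _ h => h, fun _ _ => by simp⟩

theorem comp {P : (ℕ → ℕ) → β → Prop} (hP : Semi P) {f : α → β} (hf : Computable f) :
    Semi fun p x => P p (f x) := by
  obtain ⟨R, h1, h2, h3⟩ := hP
  exact ⟨fun u x => R u (f x), h1.comp (f := fun x : List ℕ × β => R x.1 x.2)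
    (g := fun x : List ℕ × α => (x.1, f x.2)) (by fun_prop), fun u v x => h2 u v _,
    fun p x => h3 p _⟩

theorem or {P Q : (ℕ → ℕ) → α → Prop} (hP : Semi P) (hQ : Semi Q) :
    Semi fun p x => P p x ∨ Q p x := by
  obtain ⟨R, h1, h2, h3⟩ := hP
  obtain ⟨S, h4, h5, h6⟩ := hQ
  refine ⟨fun u x => R u x || S u x, by fun_prop, fun u v x huv h => ?_, fun p x => ?_⟩
  · rw [Bool.or_eq_true] at h ⊢
    exact h.imp (h2 u v x huv) (h5 u v x huv)
  · simp only [h3, h6, Bool.or_eq_true, exists_or]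

theorem and {P Q : (ℕ → ℕ) → α → Prop} (hP : Semi P) (hQ : Semi Q) :
    Semi fun p x => P p x ∧ Q p x := by
  obtain ⟨R, h1, h2, h3⟩ := hP
  obtain ⟨S, h4, h5, h6⟩ := hQ
  refine ⟨fun u x => R u x && S u x, by fun_prop, fun u v x huv h => ?_, fun p x => ?_⟩
  · rw [Bool.and_eq_true] at h ⊢
    exact h.imp (h2 u v x huv) (h5 u v x huv)
  · simp only [h3, h6, Bool.and_eq_true]
    constructor
    · rintro ⟨⟨m, hm⟩, n, hn⟩
      exact ⟨max m n, h2 _ _ x (pref_prefix p (le_max_left _ _)) hm,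
        h5 _ _ x (pref_prefix p (le_max_right _ _)) hn⟩
    · rintro ⟨m, h, h'⟩
      exact ⟨⟨m, h⟩, m, h'⟩

/-- Closure under bounded universal quantification. -/
theorem forall_lt {P : (ℕ → ℕ) → α × ℕ → Prop} (hP : Semi P) {n : α → ℕ} (hn : Computable n) :
    Semi fun p x => ∀ l < n x, P p (x, l) := by
  obtain ⟨R, h1, h2, h3⟩ := hP
  have h4 : Computable fun y : (List ℕ × α) × ℕ => R y.1.1 (y.1.2, y.2) :=
    h1.comp (f := fun x : List ℕ × α × ℕ => R x.1 x.2)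
      (g := fun y : (List ℕ × α) × ℕ => (y.1.1, (y.1.2, y.2))) (by fun_prop)
  refine ⟨fun u x => (List.range (n x)).all fun l => R u (x, l), by fun_prop,
    fun u v x huv h => ?_, fun p x => ?_⟩
  · rw [List.all_eq_true] at h ⊢
    exact fun l hl => h2 u v _ huv (h l hl)
  · simp only [List.all_eq_true, List.mem_range]
    constructor
    · intro h
      choose! m hm using fun l hl => (h3 p (x, l)).1 (h l hl)
      refine ⟨(Finset.range (n x)).sup m, fun l hl => h2 _ _ _ (pref_prefix p ?_) (hm l hl)⟩
      exact Finset.le_sup (f := m) (Finset.mem_range.2 hl)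
    · rintro ⟨m, hm⟩ l hl
      exact (h3 p (x, l)).2 ⟨m, hm l hl⟩

/-- Uniformization: a semidecidable relation has a computable choice function. -/
theorem exists_choice {P : (ℕ → ℕ) → ℕ × ℕ → Prop} (hP : Semi P) :
    ∃ F : (ℕ → ℕ) →. (ℕ → ℕ), ComputableFun F ∧
      ∀ p, (∀ n, ∃ v, P p (n, v)) → ∃ q ∈ F p, ∀ n, P p (n, q n) := by
  classical
  obtain ⟨R, h1, -, h3⟩ := hP
  -- `hit u n y`: the code `y = ⟨m, v⟩` witnesses the value `v` for the argument `n`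
  let hit : List ℕ → ℕ → ℕ → Bool := fun u n y => R (u.take y.unpair.1) (n, y.unpair.2)
  let hitp : (ℕ → ℕ) → ℕ → ℕ → Bool := fun p n y => R (pref p y.unpair.1) (n, y.unpair.2)
  let ok : List ℕ → ℕ → Bool := fun u n => (List.range u.length).any (hit u n)
  let val : List ℕ → ℕ → ℕ := fun u n => (firstBelow (hit u n) u.length).unpair.2
  let len : List ℕ → ℕ := fun u => firstBelow (fun n => !ok u n) u.length
  have c1 : Computable fun x : (List ℕ × ℕ) × ℕ => hit x.1.1 x.1.2 x.2 :=
    h1.comp (f := fun x : List ℕ × ℕ × ℕ => R x.1 x.2)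
      (g := fun x : (List ℕ × ℕ) × ℕ => (x.1.1.take x.2.unpair.1, (x.1.2, x.2.unpair.2)))
      (by fun_prop)
  have c2 : Computable fun x : List ℕ × ℕ => ok x.1 x.2 := by fun_prop
  have c3 : Computable fun x : List ℕ × ℕ => val x.1 x.2 := by fun_prop
  have c4 : Computable len := by fun_prop
  have hlen : ∀ u n, n ≤ len u ↔ n ≤ u.length ∧ ∀ i < n, ∃ y < u.length, hit u i y = true := by
    intro u n
    simp only [len, le_firstBelow_iff, ok]
    simp
  have hext : ∀ u v n y, u <+: v → y < u.length → hit v n y = hit u n y := by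
    rintro u _ n y ⟨w, rfl⟩ hy
    simp only [hit]
    rw [List.take_append_of_le_length ((Nat.unpair_left_le y).trans hy.le)]
  have hval : ∀ u n (h : ∃ y, hit u n y = true), (∃ y < u.length, hit u n y = true) →
      val u n = (Nat.find h).unpair.2 := by
    rintro u n h ⟨y, hy, hy'⟩
    simp only [val]
    rw [firstBelow_eq_find h (lt_of_le_of_lt (Nat.find_min' h hy') hy)]
  have hfind : ∀ (f g : ℕ → Bool) (b : ℕ) (hf : ∃ y, f y = true) (hg : ∃ y, g y = true),
      (∀ y < b, f y = g y) → (∃ y < b, f y = true) → Nat.find hf = Nat.find hg := by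
    rintro f g b hf hg hfg ⟨y, hy, hfy⟩
    have h4 : Nat.find hf < b := lt_of_le_of_lt (Nat.find_min' hf hfy) hy
    have h5 : Nat.find hg ≤ Nat.find hf := Nat.find_min' hg (hfg _ h4 ▸ Nat.find_spec hf)
    refine le_antisymm (Nat.find_min' hf ?_) h5
    rw [hfg _ (h5.trans_lt h4)]
    exact Nat.find_spec hg
  let D : (ℕ → ℕ) → Prop := fun p => ∀ n, ∃ y, hitp p n y = true
  let F : (ℕ → ℕ) →. (ℕ → ℕ) := fun p => ⟨D p, fun h n => (Nat.find (h n)).unpair.2⟩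
  have hp : ∀ p m n y, y < m → hit (pref p m) n y = hitp p n y := by
    intro p m n y hy
    simp only [hit, hitp]
    rw [take_pref p ((Nat.unpair_left_le y).trans hy.le)]
  refine ⟨F, ⟨fun u => (List.range (len u)).map (val u), by fun_prop, ?_, ?_⟩, ?_⟩
  · intro u v huv
    have hl : len u ≤ len v := by
      refine (hlen v _).2 ⟨(firstBelow_le _ _).trans huv.length_le, fun i hi => ?_⟩
      obtain ⟨y, hy, h⟩ := ((hlen u _).1 le_rfl).2 i hi
      exact ⟨y, hy.trans_le huv.length_le, by rwa [hext u v i y huv hy]⟩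
    have h4 : (List.range (len u)).map (val u) = (List.range (len u)).map (val v) := by
      apply List.map_congr_left
      intro i hi
      obtain ⟨y, hy, h⟩ := ((hlen u _).1 le_rfl).2 i (List.mem_range.1 hi)
      have h' : hit v i y = true := by rwa [hext u v i y huv hy]
      rw [hval u i ⟨y, h⟩ ⟨y, hy, h⟩, hval v i ⟨y, h'⟩ ⟨y, hy.trans_le huv.length_le, h'⟩,
        hfind _ _ u.length _ ⟨y, h'⟩ (fun z hz => (hext u v i z huv hz).symm) ⟨y, hy, h⟩]
    beta_reduce
    rw [h4]
    exact pref_prefix (val v) hl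
  · rintro p q ⟨hD, rfl⟩
    have h4 : ∀ m, (List.range (len (pref p m))).map (val (pref p m)) =
        pref ((F p).get hD) (len (pref p m)) := by
      intro m
      apply List.map_congr_left
      intro i hi
      obtain ⟨y, hy, h⟩ := ((hlen (pref p m) _).1 le_rfl).2 i (List.mem_range.1 hi)
      rw [hval _ i ⟨y, h⟩ ⟨y, hy, h⟩]
      rw [length_pref] at hy
      exact congrArg (fun k => (Nat.unpair k).2)
        (hfind _ _ m _ (hD i) (fun z hz => hp p m i z hz) ⟨y, hy, h⟩)
    refine ⟨fun m => ⟨_, h4 m⟩, fun n => ?_⟩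
    choose y hy using (show ∀ n, ∃ y, hitp p n y = true from hD)
    refine ⟨max n ((Finset.range n).sup y + 1), ?_⟩
    beta_reduce
    rw [h4]
    refine pref_prefix _ ((hlen _ _).2 ⟨by simp, fun i hi => ⟨y i, ?_, ?_⟩⟩)
    · rw [length_pref]
      have := Finset.le_sup (f := y) (Finset.mem_range.2 hi)
      omega
    · rw [hp]
      · exact hy i
      · have := Finset.le_sup (f := y) (Finset.mem_range.2 hi)
        omega
  · intro p h
    have hD : D p := by
      intro n
      obtain ⟨v, hv⟩ := h n
      obtain ⟨m, hm⟩ := (h3 p _).1 hv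
      exact ⟨Nat.pair m v, by simpa [hitp] using hm⟩
    exact ⟨_, ⟨hD, rfl⟩, fun n => (h3 p _).2 ⟨_, Nat.find_spec (hD n)⟩⟩

end Semi

/-- A sequence whose `n`-th entry is obtained computably from the prefix of length `n` of the
input is computed by a computable function. -/
theorem computableFun_of_pref {G : List ℕ → ℕ} (hG : Computable G) :
    ComputableFun fun p => Part.some fun n => G (pref p n) := by
  have h : Computable fun x : List ℕ × ℕ × ℕ =>
      (x.1.length == x.2.1) && (G x.1 == x.2.2) := by fun_prop
  obtain ⟨F, hF, h1⟩ := (Semi.of_pref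
    (T := fun u (x : ℕ × ℕ) => (u.length == x.1) && (G u == x.2)) h).exists_choice
  suffices hFG : F = fun p => Part.some fun n => G (pref p n) by rwa [← hFG]
  funext p
  obtain ⟨q, hq, h2⟩ := h1 p fun n => ⟨G (pref p n), n, by simp⟩
  obtain rfl : q = fun n => G (pref p n) := by
    funext n
    obtain ⟨m, hm⟩ := h2 n
    simp only [length_pref, Bool.and_eq_true, beq_iff_eq] at hm
    rw [← hm.2, hm.1]
  exact Part.eq_some_iff.2 hq

/-! ### Reductions -/

namespace Problem

variable {X Y Z W U V : Type*}

/-- A strong reduction can be checked pointwise on names. -/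
theorem StrongReducible.of_forall {f : Problem X Y} {g : Problem Z W}
    {K H : (ℕ → ℕ) →. (ℕ → ℕ)} (hK : ComputableFun K) (hH : ComputableFun H)
    (h : ∀ p x, f.inRep.names p x → x ∈ f.dom → ∃ p' ∈ K p, ∃ x', g.inRep.names p' x' ∧
      x' ∈ g.dom ∧ ∀ q y, g.outRep.names q y → y ∈ g.val x' →
        ∃ r ∈ H q, ∃ y', f.outRep.names r y' ∧ y' ∈ f.val x) :
    f.StrongReducible g := by
  refine ⟨K, H, hK, hH, fun G hG p x hp hx => ?_⟩
  obtain ⟨p', hp', x', hx', hxd, h'⟩ := h p x hp hx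
  obtain ⟨q, hq, y, hy, hyv⟩ := hG p' x' hx' hxd
  obtain ⟨r, hr, y', hy'⟩ := h' q y hy hyv
  refine ⟨r, ?_, y', hy'⟩
  exact Part.mem_bind_iff.2 ⟨q, Part.mem_bind_iff.2 ⟨p', hp', hq⟩, hr⟩

theorem StrongReducible.trans {f : Problem X Y} {g : Problem Z W} {e : Problem U V}
    (hfg : f.StrongReducible g) (hge : g.StrongReducible e) : f.StrongReducible e := by
  obtain ⟨K, H, hK, hH, h⟩ := hfg
  obtain ⟨K', H', hK', hH', h'⟩ := hge
  refine ⟨K'.comp K, H.comp H', hK'.comp hK, hH.comp hH', fun G hG => ?_⟩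
  have := h _ (h' G hG)
  rwa [PFun.comp_assoc, PFun.comp_assoc, ← PFun.comp_assoc G] at *

end Problem

/-! ### Limits on Baire space -/

/-- The guess, made at stage `s`, that `b` is the entry at position `l` of the limit of the rows of
`p` is refuted by a later row. -/
def Refuted (p : ℕ → ℕ) (x : ℕ × ℕ × ℕ) : Prop :=
  ∃ t, x.2.2 ≤ t ∧ p (Nat.pair t x.1) ≠ x.2.1

theorem semi_refuted : Semi Refuted := by
  have h : Computable fun x : ℕ × ℕ × (ℕ × ℕ × ℕ) =>
      (x.1.unpair.1.unpair.2 == x.2.2.1) && decide (x.2.2.2.2 < x.1.unpair.1.unpair.1 + 1) &&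
        !(x.2.1 == x.2.2.2.1) := by fun_prop
  have h1 := Semi.of_entry (T := fun k v (x : ℕ × ℕ × ℕ) =>
    (k.unpair.1.unpair.2 == x.1) && decide (x.2.2 < k.unpair.1.unpair.1 + 1) &&
      !(v == x.2.1)) h
  have h2 : Refuted = fun p (x : ℕ × ℕ × ℕ) => ∃ k : ℕ,
      ((k.unpair.1.unpair.2 == x.1) && decide (x.2.2 < k.unpair.1.unpair.1 + 1) &&
        !(p k.unpair.1 == x.2.1)) = true := by
    funext p x
    simp only [Refuted, eq_iff_iff, Bool.and_eq_true, decide_eq_true_eq, Bool.not_eq_true',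
      beq_eq_false_iff_ne, beq_iff_eq, Nat.lt_succ_iff, ne_eq]
    constructor
    · rintro ⟨t, ht, h⟩
      exact ⟨Nat.pair (Nat.pair t x.1) 0, by simp [ht, h]⟩
    · rintro ⟨k, ⟨hk, hs⟩, h⟩
      refine ⟨_, hs, ?_⟩
      rwa [← hk, Nat.pair_unpair]
  rw [h2]
  exact h1

theorem tendsto_row_iff {p q : ℕ → ℕ} :
    Tendsto (row p) atTop (𝓝 q) ↔ ∀ l, ∃ s, ∀ t ≥ s, p (Nat.pair t l) = q l := by
  simp only [tendsto_pi_nhds, nhds_discrete, tendsto_pure, eventually_atTop, row]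

theorem not_refuted_mono {p : ℕ → ℕ} {l b s s' : ℕ} (h : ¬ Refuted p (l, b, s)) (hs : s ≤ s') :
    ¬ Refuted p (l, b, s') := fun ⟨t, ht, h'⟩ => h ⟨t, hs.trans ht, h'⟩

theorem eq_of_not_refuted {p q : ℕ → ℕ} (hq : Tendsto (row p) atTop (𝓝 q)) {l b s : ℕ}
    (h : ¬ Refuted p (l, b, s)) : q l = b := by
  obtain ⟨s', hs'⟩ := tendsto_row_iff.1 hq l
  by_contra hne
  refine h ⟨max s s', le_max_left _ _, ?_⟩
  rwa [hs' _ (le_max_right _ _)]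

theorem exists_not_refuted {p q : ℕ → ℕ} (hq : Tendsto (row p) atTop (𝓝 q)) (l : ℕ) :
    ∃ s, ¬ Refuted p (l, q l, s) := by
  obtain ⟨s, hs⟩ := tendsto_row_iff.1 hq l
  exact ⟨s, fun ⟨t, ht, h⟩ => h (hs t ht)⟩

/-! ### Computable sequences built from prefixes -/

theorem computableFun_ite {T : List ℕ → ℕ → Bool} {m c d : ℕ → ℕ}
    (hT : Computable fun x : List ℕ × ℕ => T x.1 x.2) (hm : Computable m) (hc : Computable c)
    (hd : Computable d) (hmle : ∀ n, m n ≤ n) :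
    ComputableFun fun p => Part.some fun n => if T (pref p (m n)) n = true then c n else d n := by
  have h := computableFun_of_pref
    (G := fun u => if T (u.take (m u.length)) u.length = true then c u.length else d u.length)
    (by fun_prop)
  simpa only [length_pref, take_pref _ (hmle _)] using h

/-- Co-semidecidable sets have limit computable enumerations. -/
theorem Semi.exists_limit {P : (ℕ → ℕ) → ℕ → Prop} (hP : Semi P) {c : ℕ → ℕ} (hc : Computable c) :
    ∃ K : (ℕ → ℕ) →. (ℕ → ℕ), ComputableFun K ∧ ∀ p, ∃ q ∈ K p, ∃ r : ℕ → ℕ,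
      Tendsto (row q) atTop (𝓝 r) ∧ ∀ x, (P p x → r x = 0) ∧ (¬ P p x → r x = c x) := by
  classical
  obtain ⟨R, h1, h2, h3⟩ := hP
  have h4 : Computable fun x : List ℕ × ℕ => R x.1 x.2.unpair.2 :=
    h1.comp (f := fun x : List ℕ × ℕ => R x.1 x.2)
      (g := fun x : List ℕ × ℕ => (x.1, x.2.unpair.2)) (by fun_prop)
  refine ⟨_, computableFun_ite (T := fun u n => R u n.unpair.2) (m := fun n => n.unpair.1)
    (c := fun _ => 0) (d := fun n => c n.unpair.2) h4 (by fun_prop) (by fun_prop) (by fun_prop)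
    Nat.unpair_left_le, fun p => ⟨_, Part.mem_some _, fun x => if P p x then 0 else c x, ?_, ?_⟩⟩
  · refine tendsto_row_iff.2 fun x => ?_
    simp only [Nat.unpair_pair]
    by_cases hx : P p x
    · obtain ⟨s, hs⟩ := (h3 p x).1 hx
      exact ⟨s, fun t ht => by rw [if_pos hx, if_pos (h2 _ _ x (pref_prefix p ht) hs)]⟩
    · refine ⟨0, fun t _ => ?_⟩
      rw [if_neg hx, if_neg]
      exact fun h => hx ((h3 p x).2 ⟨t, h⟩)
  · exact fun x => ⟨fun h => if_pos h, fun h => if_neg h⟩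

/-! ### Approximations in computable metric spaces -/

namespace ComputableMetricSpace

variable {X : Type*} [MetricSpace X] (C : ComputableMetricSpace X)

theorem exists_distApprox : ∃ N : ℕ × ℕ × ℕ → ℕ, Computable N ∧
    ∀ m n k, |dist (C.α m) (C.α n) * 2 ^ k - N (m, n, k)| ≤ 2 := by
  obtain ⟨f, hf, h⟩ := C.computable_dist
  refine ⟨fun x => ((f x).unpair.1.unpair.1 - (f x).unpair.1.unpair.2) * 2 ^ x.2.2 /
    ((f x).unpair.2 + 1), by fun_prop, fun m n k => ?_⟩
  beta_reduce
  have h1 := h m n k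
  simp only [ratOf] at h1
  generalize (f (m, n, k)).unpair.1.unpair.1 = a at *
  generalize (f (m, n, k)).unpair.1.unpair.2 = b at *
  generalize (f (m, n, k)).unpair.2 = c at *
  have hd : 0 ≤ dist (C.α m) (C.α n) := dist_nonneg
  set d := dist (C.α m) (C.α n)
  have h2 : (0 : ℝ) < 2 ^ k := by positivity
  have hc : (0 : ℝ) < c + 1 := by positivity
  push_cast at h1
  have h3 : |d * 2 ^ k - ((a : ℝ) - b) * 2 ^ k / (c + 1)| ≤ 1 := by
    have : d * 2 ^ k - ((a : ℝ) - b) * 2 ^ k / (c + 1) = (d - (a - b) / (c + 1)) * 2 ^ k := by ring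
    rw [this, abs_mul, abs_of_pos h2]
    calc _ ≤ (1 / 2 : ℝ) ^ k * 2 ^ k := by gcongr
      _ = 1 := by rw [← mul_pow]; norm_num
  set z := (a - b) * 2 ^ k with hz
  have h4 : ((z / (c + 1) : ℕ) : ℝ) ≤ (z : ℝ) / (c + 1) := by
    have := Nat.cast_div_le (α := ℝ) (m := z) (n := c + 1)
    push_cast at this
    exact this
  have h5 : (z : ℝ) / (c + 1) < ((z / (c + 1) : ℕ) : ℝ) + 1 := by
    rw [div_lt_iff₀ hc]
    have := Nat.lt_mul_div_succ z (Nat.succ_pos c)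
    rw [mul_comm]
    exact_mod_cast this
  rcases le_total b a with hab | hab
  · have h6 : (z : ℝ) = ((a : ℝ) - b) * 2 ^ k := by
      rw [hz]; push_cast [Nat.cast_sub hab]; ring
    rw [← h6] at h3
    rw [abs_le] at h3 ⊢
    constructor <;> linarith [h3.1, h3.2]
  · have h6 : z = 0 := by rw [hz, Nat.sub_eq_zero_of_le hab, zero_mul]
    have h7 : ((a : ℝ) - b) * 2 ^ k / (c + 1) ≤ 0 := by
      apply div_nonpos_of_nonpos_of_nonneg _ hc.le
      have : (a : ℝ) ≤ b := by exact_mod_cast hab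
      nlinarith
    have h8 : 0 ≤ d * 2 ^ k := by positivity
    rw [abs_le] at h3
    rw [h6, Nat.zero_div, Nat.cast_zero, sub_zero, abs_of_nonneg h8]
    linarith [h3.2]

/-- A computable natural number within distance `2` of `2 ^ k` times the distance of the `m`-th and
the `n`-th point. -/
noncomputable def distApprox (m n k : ℕ) : ℕ := C.exists_distApprox.choose (m, n, k)

@[fun_prop]
theorem computable_distApprox {γ : Type*} [Primcodable γ] {f g h : γ → ℕ} (hf : Computable f)
    (hg : Computable g) (hh : Computable h) :
    Computable fun a => C.distApprox (f a) (g a) (h a) :=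
  C.exists_distApprox.choose_spec.1.comp (hf.pair (hg.pair hh))

theorem abs_distApprox (m n k : ℕ) :
    |dist (C.α m) (C.α n) * 2 ^ k - C.distApprox m n k| ≤ 2 :=
  C.exists_distApprox.choose_spec.2 m n k

/-- The decidable predicates `T n k` confirm that the closed ball of radius `2 ^ (-k)` around the
`n`-th point is contained in the set `U`, and they do so around each point of `U`, uniformly for
all large precisions `k`. In particular `U` is open. -/
def Confirms (T : ℕ → ℕ → Bool) (U : Set X) : Prop :=
  (∀ n k, T n k = true → Metric.closedBall (C.α n) ((1 / 2) ^ k) ⊆ U) ∧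
    ∀ x ∈ U, ∃ ε > 0, ∃ k₀, ∀ k ≥ k₀, ∀ n, dist x (C.α n) < ε → T n k = true

variable {C}

namespace Confirms

variable {T S : ℕ → ℕ → Bool} {U V : Set X}

theorem congr (h : C.Confirms T U) (hU : U = V) : C.Confirms T V := hU ▸ h

theorem univ : C.Confirms (fun _ _ => true) univ :=
  ⟨fun _ _ _ => subset_univ _, fun _ _ => ⟨1, one_pos, 0, fun _ _ _ _ => rfl⟩⟩

theorem inter (hT : C.Confirms T U) (hS : C.Confirms S V) :
    C.Confirms (fun n k => T n k && S n k) (U ∩ V) := by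
  constructor
  · intro n k h
    rw [Bool.and_eq_true] at h
    exact subset_inter (hT.1 n k h.1) (hS.1 n k h.2)
  · rintro x ⟨hx, hx'⟩
    obtain ⟨ε, hε, k, h⟩ := hT.2 x hx
    obtain ⟨ε', hε', k', h'⟩ := hS.2 x hx'
    refine ⟨min ε ε', lt_min hε hε', max k k', fun l hl n hn => ?_⟩
    rw [Bool.and_eq_true]
    exact ⟨h l ((le_max_left _ _).trans hl) n (hn.trans_le (min_le_left _ _)),
      h' l ((le_max_right _ _).trans hl) n (hn.trans_le (min_le_right _ _))⟩

theorem mem_of_confirms (h : C.Confirms T U) {n k : ℕ} (hT : T n k = true) {x : X}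
    (hx : dist x (C.α n) ≤ (1 / 2) ^ k) : x ∈ U := h.1 n k hT hx

/-- Around a point of `U` all sufficiently precise approximations are confirmed. -/
theorem exists_forall_ge (h : C.Confirms T U) {x : X} (hx : x ∈ U) :
    ∃ k₀, ∀ k ≥ k₀, ∀ n, dist x (C.α n) ≤ (1 / 2) ^ k → T n k = true := by
  obtain ⟨ε, hε, k, hk⟩ := h.2 x hx
  obtain ⟨N, hN⟩ := exists_pow_lt_of_lt_one hε (by norm_num : (1 / 2 : ℝ) < 1)
  refine ⟨max k N, fun l hl n hn => hk l ((le_max_left _ _).trans hl) n (lt_of_le_of_lt hn ?_)⟩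
  refine lt_of_le_of_lt (pow_le_pow_of_le_one (by norm_num) (by norm_num) ?_) hN
  exact (le_max_right _ _).trans hl

theorem isOpen (h : C.Confirms T U) : IsOpen U := by
  refine Metric.isOpen_iff.2 fun x hx => ?_
  obtain ⟨k, hk⟩ := h.exists_forall_ge hx
  obtain ⟨n, hn⟩ := C.dense.exists_dist_lt x (ε := (1 / 2 : ℝ) ^ k / 2) (by positivity)
  have hp : (0 : ℝ) < (1 / 2) ^ k := by positivity
  refine ⟨(1 / 2 : ℝ) ^ k / 2, by positivity, fun y hy => ?_⟩
  refine h.mem_of_confirms (hk k le_rfl n (by linarith)) ?_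
  have := dist_triangle y x (C.α n)
  have := Metric.mem_ball.1 hy
  linarith

theorem exists_iff_of_cauchy (h : C.Confirms T U) {p : ℕ → ℕ} {x : X}
    (hp : ∀ k, dist x (C.α (p k)) ≤ (1 / 2) ^ k) : (∃ k, T (p k) k = true) ↔ x ∈ U := by
  constructor
  · rintro ⟨k, hk⟩
    exact h.mem_of_confirms hk (hp k)
  · intro hx
    obtain ⟨k, hk⟩ := h.exists_forall_ge hx
    exact ⟨k, hk k le_rfl _ (hp k)⟩

theorem exists_index (h : C.Confirms T U) (hU : U.Nonempty) : ∃ n, C.α n ∈ U := by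
  obtain ⟨x, hx⟩ := hU
  obtain ⟨n, hn⟩ := C.dense.exists_mem_open h.isOpen ⟨x, hx⟩
  exact ⟨n, hn⟩

end Confirms

theorem dist_le_of_cauchy {p : ℕ → ℕ} {x : X} (h : C.cauchy.names p x) (k : ℕ) :
    dist x (C.α (p k)) ≤ (1 / 2) ^ k := by
  refine le_of_tendsto (h.2.dist tendsto_const_nhds) ?_
  filter_upwards [eventually_ge_atTop k] with n hn
  exact (h.1 k n hn).le

theorem cauchy_of_dist {p : ℕ → ℕ} {x : X} (h : ∀ k, dist x (C.α (p k)) < (1 / 2) ^ (k + 1)) :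
    C.cauchy.names p x := by
  refine ⟨fun k n hkn => ?_, ?_⟩
  · have h1 := h n
    have h2 := h k
    have h3 := dist_triangle_left (C.α (p n)) (C.α (p k)) x
    have h4 : (1 / 2 : ℝ) ^ (n + 1) ≤ (1 / 2) ^ (k + 1) :=
      pow_le_pow_of_le_one (by norm_num) (by norm_num) (by omega)
    have h5 : (1 / 2 : ℝ) ^ (k + 1) = (1 / 2) ^ k / 2 := by ring
    linarith
  · rw [tendsto_iff_dist_tendsto_zero]
    refine squeeze_zero (fun _ => dist_nonneg) (fun n => ?_)
      ((tendsto_add_atTop_iff_nat 1).2 (tendsto_pow_atTop_nhds_zero_of_lt_one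
        (r := (1 / 2 : ℝ)) (by norm_num) (by norm_num)))
    rw [dist_comm]
    exact (h n).le

/-- The code of the open ball of radius `2 ^ (-k)` around the `n`-th point. -/
def ballCode (n k : ℕ) : ℕ := Nat.pair n (Nat.pair (Nat.pair 1 0) (2 ^ k - 1))

@[fun_prop]
theorem computable_ballCode {γ : Type*} [Primcodable γ] {f g : γ → ℕ} (hf : Computable f)
    (hg : Computable g) : Computable fun a => ballCode (f a) (g a) := by
  unfold ballCode
  fun_prop

variable (C)

@[simp]
theorem ball_ballCode (n k : ℕ) : C.ball (ballCode n k) = Metric.ball (C.α n) ((1 / 2) ^ k) := by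
  simp [ball, ballCode, ratOf]

@[simp]
theorem ball_zero : C.ball 0 = ∅ := by
  have h : Nat.unpair 0 = (0, 0) := Nat.unpair_zero
  simp [ball, ratOf, h]

/-- The formal inclusion of the closed ball of radius `2 ^ (-k)` around the `n`-th point in the
rational open ball with code `i`. -/
noncomputable def inside (i n k : ℕ) : Bool :=
  decide ((C.distApprox n i.unpair.1 k + 3) * (i.unpair.2.unpair.2 + 1) <
    (i.unpair.2.unpair.1.unpair.1 - i.unpair.2.unpair.1.unpair.2) * 2 ^ k)

@[fun_prop]
theorem computable_inside {γ : Type*} [Primcodable γ] {f g h : γ → ℕ} (hf : Computable f)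
    (hg : Computable g) (hh : Computable h) :
    Computable fun a => C.inside (f a) (g a) (h a) := by
  unfold inside
  fun_prop

theorem confirms_inside (i : ℕ) : C.Confirms (C.inside i) (C.ball i) := by
  unfold inside ball ratOf
  generalize i.unpair.1 = c
  generalize i.unpair.2.unpair.1.unpair.1 = a
  generalize i.unpair.2.unpair.1.unpair.2 = b
  generalize i.unpair.2.unpair.2 = d
  have hd : (0 : ℝ) < d + 1 := by positivity
  push_cast
  constructor
  · intro n k h x hx
    rw [decide_eq_true_eq] at h
    have h2 : (0 : ℝ) < 2 ^ k := by positivity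
    have hab : b ≤ a := by
      by_contra hab
      rw [Nat.sub_eq_zero_of_le (not_le.1 hab).le] at h
      omega
    have h3 : ((C.distApprox n c k : ℝ) + 3) * (d + 1) < ((a : ℝ) - b) * 2 ^ k := by
      have := (Nat.cast_lt (α := ℝ)).2 h
      push_cast [Nat.cast_sub hab] at this
      exact this
    have h4 := (abs_le.1 (C.abs_distApprox n c k)).2
    have hx' : dist x (C.α n) * 2 ^ k ≤ 1 := by
      calc _ ≤ (1 / 2 : ℝ) ^ k * 2 ^ k := by gcongr; exact hx
        _ = 1 := by rw [← mul_pow]; norm_num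
    have h5 := dist_triangle x (C.α n) (C.α c)
    rw [Metric.mem_ball, lt_div_iff₀ hd]
    have h6 : dist x (C.α c) * 2 ^ k ≤ dist x (C.α n) * 2 ^ k + dist (C.α n) (C.α c) * 2 ^ k := by
      rw [← add_mul]
      exact mul_le_mul_of_nonneg_right h5 h2.le
    have h7 : dist x (C.α c) * 2 ^ k ≤ C.distApprox n c k + 3 := by linarith
    nlinarith
  · intro x hx
    rw [Metric.mem_ball] at hx
    set R : ℝ := ((a : ℝ) - b) / (d + 1) with hR
    have hRpos : 0 < R := lt_of_le_of_lt dist_nonneg hx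
    have hab : b ≤ a := by
      by_contra hab
      have : (a : ℝ) < b := by exact_mod_cast not_le.1 hab
      have := div_neg_of_neg_of_pos (sub_neg.2 this) hd
      linarith
    set δ : ℝ := (R - dist x (C.α c)) / 2 with hδ
    have hδ0 : 0 < δ := by linarith
    obtain ⟨k₀, hk₀⟩ := pow_unbounded_of_one_lt (5 / δ) (by norm_num : (1 : ℝ) < 2)
    refine ⟨δ, hδ0, k₀, fun k hk n hn => ?_⟩
    rw [decide_eq_true_eq, ← Nat.cast_lt (α := ℝ)]
    push_cast [Nat.cast_sub hab]
    have h1 : (2 : ℝ) ^ k₀ ≤ 2 ^ k := pow_le_pow_right₀ (by norm_num) hk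
    have h2 : 5 < δ * 2 ^ k := by
      have := (div_lt_iff₀ hδ0).1 (hk₀.trans_le h1)
      linarith
    have h4 := (abs_le.1 (C.abs_distApprox n c k)).1
    have h5 := dist_triangle_left (C.α n) (C.α c) x
    have h6 : dist (C.α n) (C.α c) < R - δ := by linarith
    have h7 : (0 : ℝ) < 2 ^ k := by positivity
    have h8 : (C.distApprox n c k : ℝ) + 3 < R * 2 ^ k := by nlinarith
    have h9 : ((a : ℝ) - b) = R * (d + 1) := by rw [hR]; field_simp
    rw [h9]
    nlinarith

/-- A confirmed open set is the union of the balls that are confirmed to be inside. -/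
theorem Confirms.eq_iUnion {T : ℕ → ℕ → Bool} {U : Set X} (h : C.Confirms T U) :
    U = ⋃ n, ⋃ k, ⋃ _ : T n k = true, C.ball (ballCode n k) := by
  ext x
  simp only [mem_iUnion, ball_ballCode, Metric.mem_ball, exists_prop]
  constructor
  · intro hx
    obtain ⟨k, hk⟩ := h.exists_forall_ge hx
    obtain ⟨n, hn⟩ := C.dense.exists_dist_lt x (ε := (1 / 2 : ℝ) ^ k) (by positivity)
    exact ⟨n, k, hk k le_rfl n hn.le, hn⟩
  · rintro ⟨n, k, hT, hx⟩
    exact h.mem_of_confirms hT hx.le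

/-! ### Computing names of closed sets -/

/-- Sets whose complement is a union of a co-semidecidable family of balls have computable
`ψ₋'`-names. -/
theorem exists_limit_name {P : (ℕ → ℕ) → ℕ → Prop} (hP : Semi P) {c : ℕ → ℕ} (hc : Computable c) :
    ∃ K : (ℕ → ℕ) →. (ℕ → ℕ), ComputableFun K ∧ ∀ p, ∃ q ∈ K p, ∀ A : Closeds X,
      (A : Set X) = (⋃ y, ⋃ _ : ¬ P p y, C.ball (c y))ᶜ → C.psiNeg.jump.names q A := by
  obtain ⟨K, hK, h⟩ := hP.exists_limit hc
  refine ⟨K, hK, fun p => ?_⟩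
  obtain ⟨q, hq, r, hr, h'⟩ := h p
  refine ⟨q, hq, fun A hA => ⟨r, hr, hA.trans (congrArg compl ?_)⟩⟩
  refine iUnion_congr fun y => ?_
  by_cases hy : P p y
  · simp [hy, (h' y).1 hy]
  · simp [hy, (h' y).2 hy]

/-- The version of `exists_limit_name` for sequences of closed sets. -/
theorem exists_limit_name_seq {P : (ℕ → ℕ) → ℕ × ℕ → Prop} (hP : Semi P) {c : ℕ → ℕ}
    (hc : Computable c) :
    ∃ K : (ℕ → ℕ) →. (ℕ → ℕ), ComputableFun K ∧ ∀ p, ∃ q ∈ K p, ∀ A : ℕ → Closeds X,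
      (∀ i, (A i : Set X) = (⋃ y, ⋃ _ : ¬ P p (i, y), C.ball (c y))ᶜ) →
        C.psiNeg.seq.jump.names q A := by
  obtain ⟨K, hK, h⟩ := (hP.comp (f := Nat.unpair) Computable.unpair).exists_limit
    (c := fun x => c x.unpair.2) (by fun_prop)
  refine ⟨K, hK, fun p => ?_⟩
  obtain ⟨q, hq, r, hr, h'⟩ := h p
  refine ⟨q, hq, fun A hA => ⟨r, hr, fun i => (hA i).trans (congrArg compl ?_)⟩⟩
  refine iUnion_congr fun y => ?_
  have h2 := h' (Nat.pair i y)
  simp only [Nat.unpair_pair] at h2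
  by_cases hy : P p (i, y)
  · simp [hy, row, h2.1 hy]
  · simp [hy, row, h2.2 hy]

/-- From a semidecidable `P` one can compute a positive name of the closure of a set that contains,
for every `j` for which there is such a point, exactly one point `α n` with `P (i, j, n)`. -/
theorem exists_pos_name_seq {P : (ℕ → ℕ) → ℕ × ℕ × ℕ → Prop} (hP : Semi P) :
    ∃ K : (ℕ → ℕ) →. (ℕ → ℕ), ComputableFun K ∧ ∀ p, ∃ q ∈ K p, ∃ s : ℕ → ℕ → Option ℕ,
      (∀ i j n, s i j = some n → P p (i, j, n)) ∧
      (∀ i j, (∃ n, P p (i, j, n)) → ∃ n, s i j = some n) ∧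
      ∀ A : ℕ → Closeds X, (∀ i, (A i : Set X) = closure {x | ∃ j n, s i j = some n ∧ C.α n = x}) →
        C.psiPos.seq.names q A := by
  classical
  obtain ⟨R, h1, h2, h3⟩ := hP
  -- `hit u i j y` confirms `P (i, j, n)` for `y = ⟨n, m⟩`; the point is listed for the first such `y`
  let hit : List ℕ → ℕ → ℕ → ℕ → Bool := fun u i j y => R (u.take y) (i, j, y.unpair.1)
  have c1 : Computable fun x : List ℕ × ℕ × ℕ × ℕ => hit x.1 x.2.1 x.2.2.1 x.2.2.2 :=
    h1.comp (f := fun x : List ℕ × ℕ × ℕ × ℕ => R x.1 x.2)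
      (g := fun x : List ℕ × ℕ × ℕ × ℕ => (x.1.take x.2.2.2, x.2.1, x.2.2.1, x.2.2.2.unpair.1))
      (by fun_prop)
  let first : List ℕ → ℕ → ℕ → ℕ → Bool := fun u i j y =>
    hit u i j y && (List.range y).all fun y' => !hit u i j y'
  have c2 : Computable fun x : List ℕ × ℕ =>
      hit x.1 x.2.unpair.1 x.2.unpair.2.unpair.1.unpair.1 x.2.unpair.2.unpair.1.unpair.2 :=
    c1.comp (f := fun x : List ℕ × ℕ × ℕ × ℕ => hit x.1 x.2.1 x.2.2.1 x.2.2.2)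
      (g := fun x : List ℕ × ℕ => (x.1, x.2.unpair.1, x.2.unpair.2.unpair.1.unpair.1,
        x.2.unpair.2.unpair.1.unpair.2)) (by fun_prop)
  have c3 : Computable fun z : (List ℕ × ℕ) × ℕ =>
      hit z.1.1 z.1.2.unpair.1 z.1.2.unpair.2.unpair.1.unpair.1 z.2 :=
    c1.comp (f := fun x : List ℕ × ℕ × ℕ × ℕ => hit x.1 x.2.1 x.2.2.1 x.2.2.2)
      (g := fun z : (List ℕ × ℕ) × ℕ => (z.1.1, z.1.2.unpair.1,
        z.1.2.unpair.2.unpair.1.unpair.1, z.2)) (by fun_prop)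
  have c4 : Computable fun x : List ℕ × ℕ => first x.1 x.2.unpair.1
      x.2.unpair.2.unpair.1.unpair.1 x.2.unpair.2.unpair.1.unpair.2 :=
    computable_and c2 (by fun_prop)
  refine ⟨_, computableFun_ite (T := fun u x => first u x.unpair.1
      x.unpair.2.unpair.1.unpair.1 x.unpair.2.unpair.1.unpair.2)
    (m := fun x => x.unpair.2.unpair.1.unpair.2)
    (c := fun x => x.unpair.2.unpair.1.unpair.2.unpair.1 + 1) (d := fun _ => 0) c4 (by fun_prop)
    (by fun_prop) (by fun_prop) (fun x => (Nat.unpair_right_le _).trans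
      ((Nat.unpair_left_le _).trans (Nat.unpair_right_le _))), fun p => ?_⟩
  let hitp : ℕ → ℕ → ℕ → Bool := fun i j y => R (pref p y) (i, j, y.unpair.1)
  have hfirst : ∀ i j y, first (pref p y) i j y = true ↔
      hitp i j y = true ∧ ∀ y' < y, ¬ hitp i j y' = true := by
    intro i j y
    simp only [first, hit, hitp, Bool.and_eq_true, List.all_eq_true, List.mem_range,
      take_pref p le_rfl]
    refine and_congr_right fun _ => forall₂_congr fun y' hy' => ?_
    rw [take_pref p (le_of_lt hy')]
    simp
  let s : ℕ → ℕ → Option ℕ := fun i j =>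
    if h : ∃ y, hitp i j y = true then some (Nat.find h).unpair.1 else none
  refine ⟨_, Part.mem_some _, s, ?_, ?_, ?_⟩
  · intro i j n hn
    simp only [s] at hn
    split_ifs at hn with h
    obtain rfl := Option.some_injective _ hn
    exact (h3 p _).2 ⟨_, Nat.find_spec h⟩
  · rintro i j ⟨n, hn⟩
    obtain ⟨m, hm⟩ := (h3 p _).1 hn
    have h : ∃ y, hitp i j y = true := by
      refine ⟨Nat.pair n m, ?_⟩
      simp only [hitp, Nat.unpair_pair]
      exact h2 _ _ _ (pref_prefix p (Nat.right_le_pair n m)) hm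
    exact ⟨_, dif_pos h⟩
  · intro A hA i
    refine ⟨fun J => if first (pref p J.unpair.2) i J.unpair.1 J.unpair.2 = true then
      some (C.α J.unpair.2.unpair.1) else none, fun J => ?_, ?_⟩
    · by_cases hJ : first (pref p J.unpair.2) i J.unpair.1 J.unpair.2 = true
      · simp only [hJ, if_true]
        refine ⟨fun _ => J.unpair.2.unpair.1, fun k => by simp [row, hJ], fun k n _ => ?_,
          tendsto_const_nhds⟩
        rw [dist_self]
        positivity
      · simp only [hJ]
        intro k
        simp [row, hJ]
    · rw [hA i]
      congr 1
      ext x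
      simp only [mem_ofPred_eq]
      constructor
      · rintro ⟨j, n, hn, rfl⟩
        simp only [s] at hn
        split_ifs at hn with h
        obtain rfl := Option.some_injective _ hn
        refine ⟨Nat.pair j (Nat.find h), ?_⟩
        simp only [Nat.unpair_pair]
        rw [if_pos]
        exact (hfirst _ _ _).2 ⟨Nat.find_spec h, fun y' hy' => Nat.find_min h hy'⟩
      · rintro ⟨J, hJ⟩
        split_ifs at hJ with h
        obtain rfl := Option.some_injective _ hJ
        obtain ⟨h4, h5⟩ := (hfirst _ _ _).1 h
        have h6 : ∃ y, hitp i J.unpair.1 y = true := ⟨_, h4⟩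
        refine ⟨J.unpair.1, _, dif_pos h6, ?_⟩
        rw [(Nat.find_eq_iff h6).2 ⟨h4, h5⟩]

/-! ### Positive information and limits of negative information -/

variable {C}

/-- From a positive name of `A` one can semidecide which rational balls meet `A`. -/
theorem exists_semi_meets (C : ComputableMetricSpace X) : ∃ P : (ℕ → ℕ) → ℕ × ℕ → Prop, Semi P ∧
    ∀ p (A : ℕ → Closeds X), C.psiPos.seq.names p A →
      ∀ i b, P p (i, b) ↔ (C.ball b ∩ A i).Nonempty := by
  have h : Computable fun x : ℕ × ℕ × (ℕ × ℕ) => (x.1.unpair.1.unpair.1 == x.2.2.1) &&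
      decide (0 < x.2.1) && C.inside x.2.2.2 (x.2.1 - 1) x.1.unpair.1.unpair.2.unpair.2 := by
    fun_prop
  refine ⟨_, Semi.of_entry (T := fun k v (x : ℕ × ℕ) => (k.unpair.1.unpair.1 == x.1) &&
    decide (0 < v) && C.inside x.2 (v - 1) k.unpair.1.unpair.2.unpair.2) h, fun p A hA i b => ?_⟩
  obtain ⟨s, hs, hAs⟩ := hA i
  simp only [Bool.and_eq_true, beq_iff_eq, decide_eq_true_eq]
  constructor
  · rintro ⟨k, ⟨hi, hv⟩, hk⟩
    have h1 := hs k.unpair.1.unpair.2.unpair.1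
    have h2 : row (row p i) k.unpair.1.unpair.2.unpair.1 k.unpair.1.unpair.2.unpair.2 =
        p k.unpair.1 := by
      simp only [row, Nat.pair_unpair, ← hi]
    rcases hx : s k.unpair.1.unpair.2.unpair.1 with _ | x
    · rw [hx] at h1
      have := h1 k.unpair.1.unpair.2.unpair.2
      omega
    · rw [hx] at h1
      obtain ⟨q, hq, hqx⟩ := h1
      have h3 := hq k.unpair.1.unpair.2.unpair.2
      rw [h2] at h3
      rw [h3, Nat.add_sub_cancel] at hk
      refine ⟨x, (C.confirms_inside b).mem_of_confirms hk (dist_le_of_cauchy hqx _), ?_⟩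
      rw [hAs]
      exact subset_closure ⟨_, hx⟩
  · rintro ⟨y, hyb, hyA⟩
    rw [hAs] at hyA
    obtain ⟨x, hxb, n, hx⟩ := mem_closure_iff.1 hyA _ (C.confirms_inside b).isOpen hyb
    have h1 := hs n
    rw [hx] at h1
    obtain ⟨q, hq, hqx⟩ := h1
    obtain ⟨k, hk⟩ := ((C.confirms_inside b).exists_iff_of_cauchy (dist_le_of_cauchy hqx)).2 hxb
    refine ⟨Nat.pair (Nat.pair i (Nat.pair n k)) 0, ?_⟩
    have h2 : p (Nat.pair i (Nat.pair n k)) = q k + 1 := hq k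
    simp [h2, hk]

/-- The complement of a positively given set is exhausted by the balls that are never seen to meet
it, and these can be listed in the limit. -/
theorem BCT2_strongReducible_jump_BCT0 [CompleteSpace X] : C.BCT2.StrongReducible C.BCT0.jump := by
  obtain ⟨P, hP, hPA⟩ := C.exists_semi_meets
  obtain ⟨K, hK, h⟩ := C.exists_limit_name_seq hP (c := id) Computable.id
  refine Problem.StrongReducible.of_forall hK computableFun_id fun p A hp hA => ?_
  obtain ⟨q, hq, h'⟩ := h p
  refine ⟨q, hq, A, h' A fun i => ?_, hA, fun q y hq hy => ⟨q, by simp, y, hq, hy⟩⟩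
  ext x
  simp only [id, mem_compl_iff, mem_iUnion, not_exists, hPA p A hp, not_nonempty_iff_eq_empty]
  constructor
  · intro hx b hb hxb
    have : x ∈ C.ball b ∩ A i := ⟨hxb, hx⟩
    rw [hb] at this
    exact this
  · intro hx
    by_contra hxA
    obtain ⟨b, hb, hbA⟩ := C.exists_ball (A i).isClosed.isOpen_compl hxA
    exact hx b ((disjoint_iff_inter_eq_empty).1 (disjoint_left.2 hbA)) hb

/-- The `l`-th guess `l = ⟨s, ⟨l', b⟩⟩` is that from stage `s` on the ball with code `b` is the
`l'`-th ball of the limit name of the `i`-th set. -/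
def guess (i l : ℕ) : ℕ × ℕ × ℕ :=
  (Nat.pair i l.unpair.2.unpair.1, l.unpair.2.unpair.2, l.unpair.1)

@[fun_prop]
theorem computable_guess {γ : Type*} [Primcodable γ] {f g : γ → ℕ} (hf : Computable f)
    (hg : Computable g) : Computable fun a => guess (f a) (g a) := by
  unfold guess
  fun_prop

/-- The ball of a guess that is never refuted is disjoint from the set. -/
theorem not_mem_of_guess {p : ℕ → ℕ} {A : ℕ → Closeds X} (hp : C.psiNeg.seq.jump.names p A)
    {i l : ℕ} (hl : ¬ Refuted p (guess i l)) {x : X} (hx : x ∈ C.ball l.unpair.2.unpair.2) :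
    x ∉ A i := by
  obtain ⟨q, hq, hA⟩ := hp
  have h1 : x ∈ A i ↔ x ∈ (A i : Set X) := Iff.rfl
  rw [h1, show (A i : Set X) = _ from hA i, mem_compl_iff, not_not, mem_iUnion]
  refine ⟨l.unpair.2.unpair.1, ?_⟩
  have : row q i l.unpair.2.unpair.1 = l.unpair.2.unpair.2 := eq_of_not_refuted hq hl
  rwa [this]

/-- A point outside of the set is in a ball that is guessed correctly, from arbitrarily late stages
on. -/
theorem exists_guess {p : ℕ → ℕ} {A : ℕ → Closeds X} (hp : C.psiNeg.seq.jump.names p A)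
    {i : ℕ} {x : X} (hx : x ∉ A i) :
    ∃ b, x ∈ C.ball b ∧ ∀ m, ∃ l ≥ m, ¬ Refuted p (guess i l) ∧ l.unpair.2.unpair.2 = b := by
  obtain ⟨q, hq, hA⟩ := hp
  have h1 : x ∈ A i ↔ x ∈ (A i : Set X) := Iff.rfl
  rw [h1, show (A i : Set X) = _ from hA i, mem_compl_iff, not_not, mem_iUnion] at hx
  obtain ⟨l', hx⟩ := hx
  refine ⟨_, hx, fun m => ?_⟩
  obtain ⟨s, hs⟩ := exists_not_refuted hq (Nat.pair i l')
  refine ⟨Nat.pair (max s m) (Nat.pair l' (q (Nat.pair i l'))),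
    (le_max_right s m).trans (Nat.left_le_pair _ _), ?_, ?_⟩
  · simp only [guess, Nat.unpair_pair]
    exact not_refuted_mono hs (le_max_left _ _)
  · simp [row]

/-- The points `α n` that may be listed for the `j`-th ball: they are in that ball, and for
every `l < j` the `l`-th guess is refuted or they are not recognized, at precision `j`, to be in the
`l`-th guessed ball. -/
def Listable (C : ComputableMetricSpace X) (p : ℕ → ℕ) (x : ℕ × ℕ × ℕ) : Prop :=
  (∃ k, C.inside x.2.1 x.2.2 k = true) ∧
    ∀ l < x.2.1, Refuted p (guess x.1 l) ∨ (!C.inside l.unpair.2.unpair.2 x.2.2 x.2.1) = true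

theorem semi_listable (C : ComputableMetricSpace X) : Semi C.Listable := by
  have h1 : Semi fun (_ : ℕ → ℕ) (x : ℕ × ℕ × ℕ) => ∃ k, C.inside x.2.1 x.2.2 k = true :=
    Semi.of_entry (T := fun k _ (x : ℕ × ℕ × ℕ) => C.inside x.2.1 x.2.2 k) (by fun_prop)
  have h2 : Semi fun p (y : (ℕ × ℕ × ℕ) × ℕ) => Refuted p (guess y.1.1 y.2) ∨
      (!C.inside y.2.unpair.2.unpair.2 y.1.2.2 y.1.2.1) = true :=
    (semi_refuted.comp (f := fun y : (ℕ × ℕ × ℕ) × ℕ => guess y.1.1 y.2) (by fun_prop)).or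
      (Semi.of_computable (by fun_prop))
  exact h1.and (h2.forall_lt (n := fun x : ℕ × ℕ × ℕ => x.2.1) (by fun_prop))

/-- A nowhere dense set that is given by a `ψ₋'`-name can be enlarged to a positively given nowhere
dense set: one lists for every rational ball that meets the set a point close to it; these points
form a locally finite family outside of the set. -/
theorem jump_BCT0_strongReducible_BCT2 [CompleteSpace X] [PerfectSpace X] :
    C.BCT0.jump.StrongReducible C.BCT2 := by
  obtain ⟨K, hK, h⟩ := C.exists_pos_name_seq C.semi_listable
  refine Problem.StrongReducible.of_forall hK computableFun_id fun p A hp hA => ?_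
  obtain ⟨q, hq, s, hs, hs', h'⟩ := h p
  let D : ℕ → Set X := fun i => {x | ∃ j n, s i j = some n ∧ C.α n = x}
  let B : ℕ → Closeds X := fun i => ⟨closure (D i), isClosed_closure⟩
  have hAB : ∀ i, (A i : Set X) ⊆ B i := by
    intro i x hx
    refine mem_closure_iff.2 fun O hO hxO => ?_
    obtain ⟨j, hxj, hjO⟩ := C.exists_ball hO hxO
    obtain ⟨n, hnj, hn⟩ := C.dense.exists_mem_open
      (((C.confirms_inside j).isOpen).inter (Metric.isOpen_ball (x := x) (ε := (1 / 2) ^ j)))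
      ⟨x, hxj, Metric.mem_ball_self (by positivity)⟩
    have hnP : C.Listable p (i, j, n) := by
      refine ⟨?_, fun l hl => or_iff_not_imp_left.2 fun hr => ?_⟩
      · obtain ⟨k, hk⟩ := (C.confirms_inside j).exists_forall_ge hnj
        exact ⟨k, hk k le_rfl n (by rw [dist_self]; positivity)⟩
      · by_contra hin
        rw [Bool.not_eq_true', Bool.not_eq_false] at hin
        refine not_mem_of_guess hp hr ?_ hx
        refine (C.confirms_inside _).mem_of_confirms hin ?_
        rw [dist_comm]
        exact (Metric.mem_ball.1 hn).le
    obtain ⟨n', hn'⟩ := hs' i j ⟨n, hnP⟩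
    obtain ⟨⟨k, hk⟩, -⟩ := hs i j n' hn'
    refine ⟨C.α n', hjO ?_, j, n', hn', rfl⟩
    exact (C.confirms_inside j).mem_of_confirms hk (by rw [dist_self]; positivity)
  refine ⟨q, hq, B, h' B fun i => rfl, fun i => ?_, fun q y hq hy => ⟨q, by simp, y, hq, ?_⟩⟩
  · by_contra hne
    obtain ⟨y, hy⟩ := nonempty_iff_ne_empty.2 hne
    obtain ⟨x, hxA, hxO⟩ := (interior_eq_empty_iff_dense_compl.1 (hA i)).exists_mem_open
      isOpen_interior ⟨y, hy⟩
    obtain ⟨b, hxb, hb⟩ := exists_guess hp hxA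
    obtain ⟨l, -, hl, rfl⟩ := hb 0
    obtain ⟨ε, hε, k, hk⟩ := (C.confirms_inside _).2 _ hxb
    -- only the points listed for the first `l + k + 1` balls can be close to `x`
    let F : Set X := (fun j => C.α ((s i j).getD 0)) '' {j | j ≤ l + k}
    have hF : F.Finite := (Set.finite_le_nat _).image _
    let W : Set X := interior (B i : Set X) ∩ Metric.ball x ε
    have hW : IsOpen W := isOpen_interior.inter Metric.isOpen_ball
    have hWF : W ⊆ F := by
      intro z hz
      rw [← hF.isClosed.closure_eq]
      refine mem_closure_iff.2 fun O hO hzO => ?_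
      obtain ⟨_, ⟨hO', hW'⟩, j, n, hn, rfl⟩ := mem_closure_iff.1 (interior_subset hz.1) _
        (hO.inter hW) ⟨hzO, hz⟩
      refine ⟨_, hO', j, ?_, by simp [hn]⟩
      by_contra hj
      have hj' : l + k < j := not_le.1 hj
      rcases (hs i j n hn).2 l (by dsimp only; omega) with h1 | h1
      · exact hl h1
      · dsimp only at h1
        rw [hk j (by omega) n (by rw [dist_comm]; exact hW'.2)] at h1
        exact absurd h1 (by simp)
    have hxW : W ∈ 𝓝 x := hW.mem_nhds ⟨hxO, Metric.mem_ball_self hε⟩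
    exact infinite_of_mem_nhds x hxW (hF.subset hWF)
  · intro hyA
    obtain ⟨i, hi⟩ := mem_iUnion.1 hyA
    exact hy (mem_iUnion.2 ⟨i, hAB i hi⟩)

end ComputableMetricSpace

/-! ### Words and cylinders in Cantor space -/

/-- A point of Cantor space as a function. -/
def Cantor.bit (x : Cantor) : ℕ → Bool := x

/-- The prefix of length `k` of a point of Cantor space. -/
def Cantor.pre (x : Cantor) (k : ℕ) : List Bool := (List.range k).map x.bit

theorem Cantor.length_pre (x : Cantor) (k : ℕ) : (x.pre k).length = k := by simp [Cantor.pre]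

theorem Cantor.pre_prefix (x : Cantor) {m n : ℕ} (h : m ≤ n) : x.pre m <+: x.pre n :=
  (List.prefix_iff_eq_take.2 (by simp [List.take_range, h]) : List.range m <+: List.range n).map x.bit

theorem mem_cyl_iff {x : Cantor} {w : List Bool} : x ∈ cyl w ↔ x.pre w.length = w := by
  constructor
  · intro h
    refine List.ext_getElem (by simp [Cantor.pre]) fun i h1 h2 => ?_
    simpa [Cantor.pre] using (show x.bit i = w.get ⟨i, h2⟩ from h i h2)
  · intro h i hi
    have h1 : w[i]'hi = (x.pre w.length)[i]'(by rwa [x.length_pre]) := by simp only [h]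
    change x.bit i = w.get ⟨i, hi⟩
    simpa [Cantor.pre] using h1.symm

theorem mem_cyl_iff_prefix {x : Cantor} {w : List Bool} {k : ℕ} (hk : w.length ≤ k) :
    x ∈ cyl w ↔ w <+: x.pre k := by
  rw [mem_cyl_iff]
  constructor
  · intro h
    exact h ▸ x.pre_prefix (by simpa [x.length_pre] using hk)
  · intro h
    exact (List.prefix_of_prefix_length_le (x.pre_prefix hk) h (by simp [x.length_pre])).eq_of_length
      (by simp [x.length_pre])

theorem mem_cyl_pre (x : Cantor) (k : ℕ) : x ∈ cyl (x.pre k) := by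
  rw [mem_cyl_iff, x.length_pre]

theorem cyl_subset_cyl {v w : List Bool} (h : v <+: w) : cyl w ⊆ cyl v := by
  intro x hx
  rw [mem_cyl_iff_prefix h.length_le]
  rw [mem_cyl_iff] at hx
  rwa [hx]

/-- The index of the binary sequence `w000…`. -/
def wordIndex (w : List Bool) : ℕ := w.foldr (fun b a => if b = true then 2 * a + 1 else 2 * a) 0

theorem testBit_wordIndex (w : List Bool) (i : ℕ) : (wordIndex w).testBit i = w.getD i false := by
  induction w generalizing i with
  | nil => simp [wordIndex]
  | cons b w ih =>
    have h : wordIndex (b :: w) = Nat.bit b (wordIndex w) := by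
      cases b <;> simp [wordIndex, Nat.bit]
    rw [h]
    cases i with
    | zero => simp
    | succ i => rw [Nat.testBit_bit_succ, ih]; simp

@[fun_prop]
theorem computable_wordIndex {γ : Type*} [Primcodable γ] {f : γ → List Bool} (hf : Computable f) :
    Computable fun a => wordIndex (f a) := by
  have : Computable fun a => (f a).reverse.foldl
      (fun a b => if b = true then 2 * a + 1 else 2 * a) 0 :=
    computable_foldl (Computable.list_reverse.comp hf) (by fun_prop) (by fun_prop)
  exact this.of_eq fun a => by rw [List.foldl_reverse]; rfl

theorem Cantor.dist_le_iff {x y : Cantor} {n : ℕ} :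
    dist x y ≤ (1 / 2) ^ n ↔ ∀ i < n, x i = y i := by
  exact (PiNat.mem_cylinder_iff_dist_le (E := fun _ : ℕ => Bool)).symm

theorem cyl_eq_closedBall (w : List Bool) :
    cyl w = Metric.closedBall (cantorSpace.α (wordIndex w)) ((1 / 2) ^ w.length) := by
  ext x
  rw [Metric.mem_closedBall, Cantor.dist_le_iff]
  refine forall₂_congr fun i hi => ?_
  have : cantorSpace.α (wordIndex w) i = w.get ⟨i, hi⟩ := by
    refine (testBit_wordIndex w i).trans ?_
    rw [List.getD_eq_getElem _ _ hi]
    rfl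
  rw [this]

/-- The code of a rational ball that is the cylinder of the word `w`; its radius is twice the
diameter of the cylinder. -/
def cylCode (w : List Bool) : ℕ :=
  Nat.pair (wordIndex w) (Nat.pair (Nat.pair 2 0) (2 ^ w.length - 1))

@[fun_prop]
theorem computable_cylCode {γ : Type*} [Primcodable γ] {f : γ → List Bool} (hf : Computable f) :
    Computable fun a => cylCode (f a) := by
  unfold cylCode
  fun_prop

theorem ball_cylCode (w : List Bool) : cantorSpace.ball (cylCode w) = cyl w := by
  rw [cyl_eq_closedBall]
  ext x
  have hr : ((ratOf (cylCode w).unpair.2 : ℚ) : ℝ) = 2 * (1 / 2) ^ w.length := by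
    simp [ratOf, cylCode, div_eq_mul_inv]
  have hc : (cylCode w).unpair.1 = wordIndex w := by simp [cylCode]
  rw [ComputableMetricSpace.ball, hr, hc, Metric.mem_ball, Metric.mem_closedBall]
  have hp : (0 : ℝ) < (1 / 2) ^ w.length := by positivity
  refine ⟨fun h => ?_, fun h => by linarith⟩
  generalize cantorSpace.α (wordIndex w) = y at *
  by_cases hxy : x = y
  · rw [hxy, dist_self]; exact hp.le
  · have h1 : dist x y = (1 / 2) ^ PiNat.firstDiff (E := fun _ : ℕ => Bool) x y :=
      PiNat.dist_eq_of_ne (E := fun _ : ℕ => Bool) hxy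
    rw [h1] at h ⊢
    refine pow_le_pow_of_le_one (by norm_num) (by norm_num) ?_
    by_contra hlt
    have h2 : (1 / 2 : ℝ) ^ w.length ≤
        (1 / 2) ^ (PiNat.firstDiff (E := fun _ : ℕ => Bool) x y + 1) :=
      pow_le_pow_of_le_one (by norm_num) (by norm_num) (not_le.1 hlt)
    rw [pow_succ] at h2
    linarith

theorem isOpen_cyl (w : List Bool) : IsOpen (cyl w) := by
  rw [← ball_cylCode]
  exact Metric.isOpen_ball

theorem exists_cyl_subset {O : Set Cantor} (hO : IsOpen O) {x : Cantor} (hx : x ∈ O) :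
    ∃ k, cyl (x.pre k) ⊆ O := by
  obtain ⟨ε, hε, hεO⟩ := Metric.isOpen_iff.1 hO x hx
  obtain ⟨N, hN⟩ := exists_pow_lt_of_lt_one hε (by norm_num : (1 / 2 : ℝ) < 1)
  refine ⟨N, fun y hy => hεO (lt_of_le_of_lt (Cantor.dist_le_iff.2 fun i hi => ?_) hN)⟩
  have hi' : i < (x.pre N).length := by rwa [x.length_pre]
  have h : y i = (x.pre N)[i] := hy i hi'
  rw [h]
  simp [Cantor.pre]
  rfl

theorem cyl_nonempty (w : List Bool) : (cyl w).Nonempty := by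
  rw [cyl_eq_closedBall]
  exact ⟨_, Metric.mem_closedBall_self (by positivity)⟩

/-- The union of the cylinders of a dense set of words is dense. -/
theorem interior_compl_iUnion_cyl {S : List Bool → Prop} (h : ∀ w, ∃ v, w <+: v ∧ S v) :
    interior (⋃ w, ⋃ _ : S w, cyl w)ᶜ = ∅ := by
  rw [interior_eq_empty_iff_dense_compl, compl_compl]
  refine dense_iff_inter_open.2 fun O hO => ?_
  rintro ⟨x, hx⟩
  obtain ⟨k, hk⟩ := exists_cyl_subset hO hx
  obtain ⟨v, hv, hSv⟩ := h (x.pre k)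
  obtain ⟨y, hy⟩ := cyl_nonempty v
  exact ⟨y, hk (cyl_subset_cyl hv hy), mem_iUnion₂.2 ⟨v, hSv, hy⟩⟩

/-- The word read off from a prefix of a Cauchy name of a point of Cantor space. -/
def readWord (u : List ℕ) : List Bool :=
  (List.range (u.length - 1)).map fun i => (u.getD (i + 1) 0).testBit i

@[fun_prop]
theorem computable_readWord {γ : Type*} [Primcodable γ] {f : γ → List ℕ} (hf : Computable f) :
    Computable fun a => readWord (f a) := by
  unfold readWord
  fun_prop

theorem readWord_pref {p : ℕ → ℕ} {z : Cantor} (hp : cantorSpace.cauchy.names p z) (m : ℕ) :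
    readWord (pref p m) = z.pre (m - 1) := by
  unfold readWord Cantor.pre
  rw [length_pref]
  refine List.map_congr_left fun i hi => ?_
  rw [getD_pref p (by have := List.mem_range.1 hi; omega)]
  exact (Cantor.dist_le_iff.1 (ComputableMetricSpace.dist_le_of_cauchy hp (i + 1)) i
    (Nat.lt_succ_self i)).symm

/-! ### Negative information on sets of words -/

/-- Substituting a computable map into the positions of a sequence is computable. -/
theorem computableFun_comp_right {f : ℕ → ℕ} (hf : Computable f) :
    ComputableFun fun p => Part.some fun n => p (f n) := by
  have h : Computable fun x : ℕ × ℕ × (ℕ × ℕ) =>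
      (x.1.unpair.1 == f x.2.2.1) && (x.2.1 == x.2.2.2) := by fun_prop
  obtain ⟨F, hF, h1⟩ := (Semi.of_entry
    (T := fun k v (x : ℕ × ℕ) => (k.unpair.1 == f x.1) && (v == x.2)) h).exists_choice
  suffices hFG : F = fun p => Part.some fun n => p (f n) by rwa [← hFG]
  funext p
  obtain ⟨q, hq, h2⟩ := h1 p fun n => ⟨p (f n), Nat.pair (f n) 0, by simp⟩
  obtain rfl : q = fun n => p (f n) := by
    funext n
    obtain ⟨k, hk⟩ := h2 n
    simp only [Bool.and_eq_true, beq_iff_eq] at hk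
    rw [← hk.2, hk.1]
  exact Part.eq_some_iff.2 hq

theorem isOpen_word (S : Set Word) : IsOpen S := by
  refine Metric.isOpen_iff.2 fun w hw => ⟨1, one_pos, fun v hv => ?_⟩
  rw [Metric.mem_ball, Word.dist_def] at hv
  split_ifs at hv with h
  · exact h ▸ hw
  · exact absurd hv (lt_irrefl _)

/-- The enumeration of all words, as lists. -/
def wordAt (n : ℕ) : List Bool := Word.ofNat n

@[fun_prop]
theorem computable_wordAt {γ : Type*} [Primcodable γ] {f : γ → ℕ} (hf : Computable f) :
    Computable fun a => wordAt (f a) :=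
  (Primrec.option_getD.comp (Primrec.decode (α := List Bool)) (Primrec.const _)).to_comp.comp hf

theorem wordAt_encode (w : List Bool) : wordAt (Encodable.encode w) = w := by
  change (Encodable.decode (α := List Bool) (Encodable.encode w)).getD [] = w
  rw [Encodable.encodek]
  rfl

theorem wordSpace_α_encode (w : List Bool) :
    wordSpace.α (Encodable.encode w) = (w : Word) :=
  wordAt_encode w

theorem wordSpace_ball_ballCode (n : ℕ) :
    wordSpace.ball (ComputableMetricSpace.ballCode n 1) = {wordSpace.α n} := by
  ext w
  rw [ComputableMetricSpace.ball_ballCode, Metric.mem_ball, Word.dist_def, mem_singleton_iff]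
  split_ifs with h <;> simp [h]
  norm_num

/-- From a negative name of a set of words one can enumerate its complement. -/
theorem exists_semi_not_mem_words : ∃ P : (ℕ → ℕ) → ℕ × List Bool → Prop, Semi P ∧
    ∀ p i (E : Closeds Word), wordSpace.psiNeg.names (row p i) E →
      ∀ w : Word, P p (i, w) ↔ w ∉ E := by
  have he : Computable fun x : ℕ × ℕ × (ℕ × List Bool) => Encodable.encode x.2.2.2 :=
    Computable.encode.comp (by fun_prop)
  have h : Computable fun x : ℕ × ℕ × (ℕ × List Bool) => (x.1.unpair.1.unpair.1 == x.2.2.1) &&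
      wordSpace.inside x.2.1 (Encodable.encode x.2.2.2) x.1.unpair.2 := by
    fun_prop
  refine ⟨_, Semi.of_entry (T := fun k v (x : ℕ × List Bool) => (k.unpair.1.unpair.1 == x.1) &&
    wordSpace.inside v (Encodable.encode x.2) k.unpair.2) h, fun p i E hE w => ?_⟩
  have h1 : w ∈ E ↔ w ∈ (E : Set Word) := Iff.rfl
  rw [h1, show (E : Set Word) = _ from hE, mem_compl_iff, not_not, mem_iUnion]
  have h2 : ∀ b, (∃ k, wordSpace.inside b (Encodable.encode (show List Bool from w)) k = true) ↔
      w ∈ wordSpace.ball b := fun b =>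
    (wordSpace.confirms_inside b).exists_iff_of_cauchy
      (p := fun _ => Encodable.encode (show List Bool from w))
      fun k => by rw [wordSpace_α_encode, dist_self]; positivity
  simp only [Bool.and_eq_true, beq_iff_eq]
  constructor
  · rintro ⟨k, hi, hk⟩
    refine ⟨k.unpair.1.unpair.2, (h2 _).1 ⟨k.unpair.2, ?_⟩⟩
    rwa [row, ← hi, Nat.pair_unpair]
  · rintro ⟨m, hm⟩
    obtain ⟨k, hk⟩ := (h2 _).2 hm
    exact ⟨Nat.pair (Nat.pair i m) k, by simpa [row] using hk⟩

/-- Sets whose complement is the union of a co-semidecidable family of cylinders have computable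
`ψ_#`-names. -/
theorem exists_sharp_name_seq {P : (ℕ → ℕ) → ℕ × List Bool → Prop} (hP : Semi P) :
    ∃ K : (ℕ → ℕ) →. (ℕ → ℕ), ComputableFun K ∧ ∀ p, ∃ q ∈ K p, ∀ A : ℕ → Closeds Cantor,
      (∀ i, (A i : Set Cantor) = (⋃ w, ⋃ _ : ¬ P p (i, w), cyl w)ᶜ) → psiSharp.seq.names q A := by
  obtain ⟨R, h1, h2, h3⟩ := hP
  have c1 : Computable fun x : List ℕ × ℕ => R x.1 (x.2.unpair.1, wordAt x.2.unpair.2.unpair.2) :=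
    h1.comp (f := fun x : List ℕ × ℕ × List Bool => R x.1 x.2)
      (g := fun x : List ℕ × ℕ => (x.1, x.2.unpair.1, wordAt x.2.unpair.2.unpair.2)) (by fun_prop)
  refine ⟨_, computableFun_ite (T := fun u x => R u (x.unpair.1, wordAt x.unpair.2.unpair.2))
    (m := fun x => x.unpair.2.unpair.1)
    (c := fun x => ComputableMetricSpace.ballCode x.unpair.2.unpair.2 1) (d := fun _ => 0) c1
    (by fun_prop) (by fun_prop) (by fun_prop)
    (fun x => (Nat.unpair_left_le _).trans (Nat.unpair_right_le _)),
    fun p => ⟨_, Part.mem_some _, fun A hA i => ?_⟩⟩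
  refine ⟨⟨{w | ¬ P p (i, w)}, ⟨isOpen_word _⟩⟩, ?_, hA i⟩
  ext w
  rw [mem_compl_iff, mem_iUnion]
  change ¬ P p (i, w) ↔ _
  rw [not_iff_not, h3]
  constructor
  · rintro ⟨m, hm⟩
    refine ⟨Nat.pair m (Encodable.encode (show List Bool from w)), ?_⟩
    simp only [row, Nat.unpair_pair]
    have hw : wordAt (Encodable.encode (show List Bool from w)) = w := wordSpace_α_encode _
    rw [hw, if_pos hm, wordSpace_ball_ballCode]
    exact (wordSpace_α_encode _).symm
  · rintro ⟨n, hn⟩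
    simp only [row, Nat.unpair_pair] at hn
    split_ifs at hn with h
    · rw [wordSpace_ball_ballCode] at hn
      exact ⟨_, (show w = wordAt n.unpair.2 from hn) ▸ h⟩
    · rw [ComputableMetricSpace.ball_zero] at hn
      exact hn.elim

/-! ### The two representations of the closed subsets of Cantor space -/

/-- The length of a word serves as a guess of a ball of the limit name, made at a certain stage; a
word is put into the set if the guess is never refuted and the cylinder is inside of the ball. -/
theorem jump_psiNeg_reducible_psiSharp : cantorSpace.psiNeg.jump.Reducible psiSharp := by
  have h1 : Semi fun p (x : ℕ × List Bool) => Refuted p (ComputableMetricSpace.guess x.1 x.2.length) ∨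
      (!cantorSpace.inside x.2.length.unpair.2.unpair.2 (wordIndex x.2) x.2.length) = true :=
    (semi_refuted.comp (f := fun x : ℕ × List Bool =>
      ComputableMetricSpace.guess x.1 x.2.length) (by fun_prop)).or
      (Semi.of_computable (by fun_prop))
  obtain ⟨K, hK, h⟩ := exists_sharp_name_seq h1
  let f : ℕ → ℕ := fun n => Nat.pair n.unpair.1 n.unpair.2.unpair.2
  refine ⟨_, (computableFun_comp_right (f := fun n => Nat.pair 0 n) (by fun_prop)).comp
    (hK.comp (computableFun_comp_right (f := f) (by fun_prop))), fun p A hA => ?_⟩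
  obtain ⟨q, hq, h'⟩ := h fun n => p (f n)
  refine ⟨row q 0, Part.mem_bind_iff.2 ⟨q, Part.mem_bind_iff.2 ⟨_, Part.mem_some _, hq⟩,
    Part.mem_some _⟩, h' (fun _ => A) (fun i => ?_) 0⟩
  have hp : cantorSpace.psiNeg.seq.jump.names (fun n => p (f n)) fun _ => A := by
    obtain ⟨r, hr, hrA⟩ := hA
    refine ⟨fun n => r n.unpair.2, tendsto_row_iff.2 fun l => ?_, fun i => ?_⟩
    · obtain ⟨s, hs⟩ := tendsto_row_iff.1 hr l.unpair.2
      exact ⟨s, fun t ht => by simpa [f] using hs t ht⟩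
    · have : row (fun n => r n.unpair.2) i = r := by
        funext j
        simp [row]
      rwa [this]
  rw [eq_compl_comm]
  ext x
  simp only [mem_compl_iff, mem_iUnion, exists_prop, not_or, Bool.not_eq_true', Bool.not_eq_false]
  constructor
  · rintro ⟨w, ⟨hw, hin⟩, hx⟩
    refine ComputableMetricSpace.not_mem_of_guess hp hw ?_
    rw [cyl_eq_closedBall] at hx
    exact (cantorSpace.confirms_inside _).mem_of_confirms hin hx
  · intro hx
    obtain ⟨b, hxb, hb⟩ := ComputableMetricSpace.exists_guess hp (i := i) hx
    obtain ⟨m, hm⟩ := (cantorSpace.confirms_inside b).exists_forall_ge hxb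
    obtain ⟨l, hl, hlr, rfl⟩ := hb m
    refine ⟨x.pre l, ⟨?_, ?_⟩, mem_cyl_pre x l⟩
    · rwa [x.length_pre]
    · rw [x.length_pre]
      refine hm l hl _ ?_
      have := mem_cyl_pre x l
      rw [cyl_eq_closedBall, x.length_pre] at this
      exact this

theorem psiSharp_reducible_jump_psiNeg : psiSharp.Reducible cantorSpace.psiNeg.jump := by
  obtain ⟨P, hP, hPE⟩ := exists_semi_not_mem_words
  have h1 : Semi fun p n => P p (0, wordAt n) := hP.comp (f := fun n => (0, wordAt n)) (by fun_prop)
  obtain ⟨K, hK, h⟩ := cantorSpace.exists_limit_name h1 (c := fun n => cylCode (wordAt n))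
    (by fun_prop)
  refine ⟨_, hK.comp (computableFun_comp_right (f := fun n => n.unpair.2) (by fun_prop)),
    fun p A hA => ?_⟩
  obtain ⟨E, hE, hAE⟩ := hA
  obtain ⟨q, hq, h'⟩ := h fun n => p n.unpair.2
  refine ⟨q, Part.mem_bind_iff.2 ⟨_, Part.mem_some _, hq⟩, h' A ?_⟩
  have hE' : wordSpace.psiNeg.names (row (fun n => p n.unpair.2) 0) E := by
    have : row (fun n => p n.unpair.2) 0 = p := by
      funext j
      simp [row]
    rwa [this]
  rw [hAE, compl_inj_iff]
  ext x
  simp only [mem_iUnion, exists_prop, ball_cylCode]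
  constructor
  · rintro ⟨w, hw, hx⟩
    have : wordAt (Encodable.encode (show List Bool from w)) = w := wordSpace_α_encode _
    refine ⟨_, ?_, this.symm ▸ hx⟩
    rw [this]
    exact fun h => (hPE _ 0 E hE' w).1 h hw
  · rintro ⟨n, hn, hx⟩
    refine ⟨_, ?_, hx⟩
    by_contra h
    exact hn ((hPE _ 0 E hE' _).2 h)

namespace ComputableMetricSpace

variable {X : Type*} [MetricSpace X] (C : ComputableMetricSpace X)

/-! ### From Cantor space to a complete space -/

/-- One step of the interpretation of a bit sequence as a shrinking sequence of balls. The state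
`(n, e, j)` stands for the current closed ball, of radius `2 ^ (-e)` around `α n`, and for the
number `j` of zeros read since the last one. Reading a one, the current ball is replaced by the ball
that is coded by `j`, if the latter is formally inside of the current ball and has a smaller
radius. -/
noncomputable def ballStep (s : ℕ × ℕ × ℕ) (b : Bool) : ℕ × ℕ × ℕ :=
  if b = true then
    if (C.inside (ballCode s.1 s.2.1) s.2.2.unpair.1 s.2.2.unpair.2 &&
      decide (s.2.1 < s.2.2.unpair.2)) = true then (s.2.2.unpair.1, s.2.2.unpair.2, 0)
    else (s.1, s.2.1, 0)
  else (s.1, s.2.1, s.2.2 + 1)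

/-- The state after reading the word `w`. -/
noncomputable def ballState (w : List Bool) : ℕ × ℕ × ℕ := w.foldl C.ballStep (0, 0, 0)

@[fun_prop]
theorem computable_ballState {γ : Type*} [Primcodable γ] {f : γ → List Bool} (hf : Computable f) :
    Computable fun a => C.ballState (f a) := by
  have h : Computable fun x : γ × (ℕ × ℕ × ℕ) × Bool => C.ballStep x.2.1 x.2.2 := by
    unfold ballStep
    fun_prop
  exact computable_foldl (f := fun _ => C.ballStep) hf (by fun_prop) h

/-- The current closed ball after reading the word `w`. -/
def stateBall (w : List Bool) : Set X :=
  Metric.closedBall (C.α (C.ballState w).1) ((1 / 2) ^ (C.ballState w).2.1)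

theorem ballState_concat (w : List Bool) (b : Bool) :
    C.ballState (w ++ [b]) = C.ballStep (C.ballState w) b := by
  simp [ballState]

theorem ballState_zeros (w : List Bool) (r : ℕ) : C.ballState (w ++ List.replicate r false) =
    ((C.ballState w).1, (C.ballState w).2.1, (C.ballState w).2.2 + r) := by
  induction r with
  | zero => simp
  | succ r ih =>
    rw [List.replicate_succ', ← List.append_assoc, ballState_concat, ih]
    simp [ballStep, add_assoc]

theorem stateBall_mono {v w : List Bool} (h : v <+: w) :
    C.stateBall w ⊆ C.stateBall v ∧ (C.ballState v).2.1 ≤ (C.ballState w).2.1 := by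
  obtain ⟨u, rfl⟩ := h
  induction u using List.reverseRecOn with
  | nil => simp
  | append_singleton u b ih =>
    rw [← List.append_assoc]
    generalize v ++ u = w at *
    suffices h : C.stateBall (w ++ [b]) ⊆ C.stateBall w ∧
        (C.ballState w).2.1 ≤ (C.ballState (w ++ [b])).2.1 from
      ⟨h.1.trans ih.1, ih.2.trans h.2⟩
    unfold stateBall
    rw [ballState_concat, ballStep]
    split_ifs with h1 h2
    · rw [Bool.and_eq_true, decide_eq_true_eq] at h2
      refine ⟨((C.confirms_inside _).1 _ _ h2.1).trans ?_, h2.2.le⟩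
      rw [ball_ballCode]
      exact Metric.ball_subset_closedBall
    · exact ⟨Subset.rfl, le_rfl⟩
    · exact ⟨Subset.rfl, le_rfl⟩

/-- Every sufficiently small ball around a point of the interior of the current ball can be made the
current ball, after arbitrarily long words. -/
theorem exists_ballState_eq (w : List Bool) : ∃ x, ∃ e₀, ∃ O : Set X, IsOpen O ∧ x ∈ O ∧
    ∀ y ∈ O, ∀ e₁, ∃ e₂, ∀ e ≥ e₂, e₁ ≤ e ∧ ∀ n, dist y (C.α n) ≤ (1 / 2) ^ e →
      ∃ v, w <+: v ∧ v.length ≤ e₀ + Nat.pair n e ∧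
        ∀ r, (C.ballState (v ++ List.replicate r false)).1 = n ∧
          (C.ballState (v ++ List.replicate r false)).2.1 = e := by
  -- a leading one resets the counter
  set w' := w ++ [true] with hw'
  obtain ⟨n₀, e₀, h₀⟩ : ∃ n₀ e₀, C.ballState w' = (n₀, e₀, 0) := by
    rw [hw', ballState_concat, ballStep]
    rw [if_pos rfl]
    split_ifs
    exacts [⟨_, _, rfl⟩, ⟨_, _, rfl⟩]
  have hO := C.confirms_inside (ballCode n₀ e₀)
  refine ⟨C.α n₀, w.length + 2, C.ball (ballCode n₀ e₀), hO.isOpen, ?_, fun y hy e₁ => ?_⟩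
  · rw [ball_ballCode]
    exact Metric.mem_ball_self (by positivity)
  obtain ⟨k, hk⟩ := hO.exists_forall_ge hy
  refine ⟨max e₁ (max k (e₀ + 1)), fun e he => ?_⟩
  simp only [max_le_iff, ge_iff_le] at he
  refine ⟨he.1, fun n hn => ?_⟩
  refine ⟨w' ++ List.replicate (Nat.pair n e) false ++ [true], ?_, ?_, fun r => ?_⟩
  · rw [hw', List.append_assoc, List.append_assoc]
    exact List.prefix_append _ _
  · simp [hw']
    omega
  · rw [ballState_zeros, ballState_concat, ballState_zeros, h₀]
    have h1 := hk e he.2.1 n hn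
    have h2 : e₀ < e := he.2.2
    simp [ballStep, h1, h2]

/-- If the radii shrink to zero along `z`, the current balls shrink to a point. -/
theorem exists_mem_stateBall [CompleteSpace X] {z : Cantor}
    (hz : ∀ k, ∃ m, k ≤ (C.ballState (z.pre m)).2.1) : ∃ x, ∀ m, x ∈ C.stateBall (z.pre m) := by
  let c : ℕ → X := fun m => C.α (C.ballState (z.pre m)).1
  have hc : ∀ m, ∀ m' ≥ m, c m' ∈ C.stateBall (z.pre m) := fun m m' hm =>
    (C.stateBall_mono (z.pre_prefix hm)).1 (Metric.mem_closedBall_self (by positivity))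
  have hcauchy : CauchySeq c := by
    refine Metric.cauchySeq_iff'.2 fun ε hε => ?_
    obtain ⟨k, hk⟩ := exists_pow_lt_of_lt_one hε (by norm_num : (1 / 2 : ℝ) < 1)
    obtain ⟨m, hm⟩ := hz k
    refine ⟨m, fun m' hm' => lt_of_le_of_lt (Metric.mem_closedBall.1 (hc m m' hm')) ?_⟩
    exact lt_of_le_of_lt (pow_le_pow_of_le_one (by norm_num) (by norm_num) hm) hk
  obtain ⟨x, hx⟩ := cauchySeq_tendsto_of_complete hcauchy
  refine ⟨x, fun m => Metric.isClosed_closedBall.mem_of_tendsto hx ?_⟩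
  filter_upwards [eventually_ge_atTop m] with m' hm'
  exact hc m m' hm'

/-- A word is outside of the `i`-th set of words if the guess given by its length is refuted, or if
the current ball is not inside of the guessed ball or not yet of radius `2 ^ (-i)`. -/
def Excluded (p : ℕ → ℕ) (x : ℕ × List Bool) : Prop :=
  Refuted p (guess x.1 x.2.length) ∨
    (!(C.inside x.2.length.unpair.2.unpair.2 (C.ballState x.2).1 (C.ballState x.2).2.1) ||
      decide ((C.ballState x.2).2.1 < x.1)) = true

theorem semi_excluded : Semi C.Excluded :=
  (semi_refuted.comp (f := fun x : ℕ × List Bool => guess x.1 x.2.length) (by fun_prop)).or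
    (Semi.of_computable (by fun_prop))

variable {C}

theorem not_excluded_iff {p : ℕ → ℕ} {i : ℕ} {w : List Bool} : ¬ C.Excluded p (i, w) ↔
    ¬ Refuted p (guess i w.length) ∧
      C.inside w.length.unpair.2.unpair.2 (C.ballState w).1 (C.ballState w).2.1 = true ∧
      i ≤ (C.ballState w).2.1 := by
  simp [Excluded]

theorem exists_not_excluded {p : ℕ → ℕ} {A : ℕ → Closeds X}
    (hp : C.psiNeg.seq.jump.names p A) {i : ℕ} (hA : interior (A i : Set X) = ∅) (w : List Bool) :
    ∃ v, w <+: v ∧ ¬ C.Excluded p (i, v) := by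
  obtain ⟨x, e₀, O, hO, hx, h⟩ := C.exists_ballState_eq w
  obtain ⟨y, hyA, hyO⟩ := (interior_eq_empty_iff_dense_compl.1 hA).exists_mem_open hO ⟨x, hx⟩
  obtain ⟨b, hyb, hb⟩ := exists_guess hp hyA
  obtain ⟨k, hk⟩ := (C.confirms_inside b).exists_forall_ge hyb
  obtain ⟨e, he⟩ := h y hyO (max i k)
  obtain ⟨n, hn⟩ := C.dense.exists_dist_lt y (ε := (1 / 2 : ℝ) ^ e) (by positivity)
  obtain ⟨he', hv⟩ := he e le_rfl
  obtain ⟨v, hwv, hv', hr⟩ := hv n hn.le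
  obtain ⟨l, hl, hlr, rfl⟩ := hb (e₀ + Nat.pair n e)
  refine ⟨v ++ List.replicate (l - v.length) false, hwv.trans (List.prefix_append _ _), ?_⟩
  have hlen : (v ++ List.replicate (l - v.length) false).length = l := by simp; omega
  rw [not_excluded_iff, hlen, (hr _).1, (hr _).2]
  exact ⟨hlr, hk e ((le_max_right _ _).trans he') n hn.le, (le_max_left _ _).trans he'⟩

variable [CompleteSpace X]

/-- A sufficiently generic bit sequence codes a sequence of balls that shrinks to a generic point. -/
theorem jump_BCT0_strongReducible_Pi01G : C.BCT0.jump.StrongReducible Pi01G := by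
  obtain ⟨K, hK, h⟩ := exists_sharp_name_seq C.semi_excluded
  have h1 : Computable fun x : List ℕ × ℕ × ℕ => ((C.ballState (readWord x.1)).1 == x.2.2) &&
    decide (x.2.1 + 1 < (C.ballState (readWord x.1)).2.1) := by fun_prop
  obtain ⟨H, hH, h2⟩ := (Semi.of_pref (T := fun u (x : ℕ × ℕ) =>
    ((C.ballState (readWord u)).1 == x.2) &&
      decide (x.1 + 1 < (C.ballState (readWord u)).2.1)) h1).exists_choice
  refine Problem.StrongReducible.of_forall hK hH fun p A hp hA => ?_
  obtain ⟨q, hq, h'⟩ := h p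
  let B : ℕ → Closeds Cantor := fun i => ⟨(⋃ w, ⋃ _ : ¬ C.Excluded p (i, w), cyl w)ᶜ,
    (isOpen_iUnion fun w => isOpen_iUnion fun _ => isOpen_cyl w).isClosed_compl⟩
  refine ⟨q, hq, B, h' B fun i => rfl, fun i => interior_compl_iUnion_cyl fun w =>
    exists_not_excluded hp (hA i) w, fun s z hs hz => ?_⟩
  have hz' : ∀ i, ∃ m, ¬ C.Excluded p (i, z.pre m) := by
    intro i
    have h3 : z ∉ (B i : Set Cantor) := fun h => hz (mem_iUnion.2 ⟨i, h⟩)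
    obtain ⟨w, hw, hzw⟩ := mem_iUnion₂.1 (not_not.1 h3)
    refine ⟨w.length, ?_⟩
    rwa [mem_cyl_iff.1 hzw]
  obtain ⟨x, hx⟩ := C.exists_mem_stateBall (z := z) fun k => by
    obtain ⟨m, hm⟩ := hz' k
    exact ⟨m, (not_excluded_iff.1 hm).2.2⟩
  obtain ⟨r, hr, hr'⟩ := h2 s fun k => by
    obtain ⟨m, hm⟩ := hz' (k + 2)
    refine ⟨(C.ballState (z.pre m)).1, m + 1, ?_⟩
    rw [readWord_pref hs, Nat.add_sub_cancel]
    have := (not_excluded_iff.1 hm).2.2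
    simp only [beq_self_eq_true, Bool.true_and, decide_eq_true_eq]
    omega
  refine ⟨r, hr, x, cauchy_of_dist fun k => ?_, ?_⟩
  · obtain ⟨m, hm⟩ := hr' k
    rw [readWord_pref hs] at hm
    simp only [Bool.and_eq_true, beq_iff_eq, decide_eq_true_eq] at hm
    rw [← hm.1]
    refine lt_of_le_of_lt (Metric.mem_closedBall.1 (hx (m - 1))) ?_
    exact pow_lt_pow_right_of_lt_one₀ (by norm_num) (by norm_num) hm.2
  · intro hxA
    obtain ⟨i, hi⟩ := mem_iUnion.1 hxA
    obtain ⟨m, hm⟩ := hz' i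
    obtain ⟨h3, h4, -⟩ := not_excluded_iff.1 hm
    exact not_mem_of_guess hp h3 ((C.confirms_inside _).mem_of_confirms h4
      (Metric.mem_closedBall.1 (hx m))) hi

end ComputableMetricSpace

namespace ComputableMetricSpace

variable {X : Type*} [MetricSpace X] (C : ComputableMetricSpace X)

/-! ### A computable family of radii that avoids all distances -/

/-- The interval `[a, a + 1] / 4 ^ s` is refined to its last or its first quarter, away from the
number `d * 2 ^ e`, where `d` is the distance of the `m`-th and the `n`-th point and
`s = ⟨m, ⟨n, e⟩⟩`. -/
noncomputable def refineStep (a s : ℕ) : ℕ :=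
  if decide (C.distApprox s.unpair.1 s.unpair.2.unpair.1 (2 * s + s.unpair.2.unpair.2 + 4) <
    16 * a + 9) = true then 4 * a + 3 else 4 * a

/-- The left endpoint, in units of `4 ^ (-s)`, of the `s`-th interval of a nested sequence. -/
noncomputable def leftEnd (s : ℕ) : ℕ := (List.range s).foldl C.refineStep 1

theorem leftEnd_succ (s : ℕ) : C.leftEnd (s + 1) = C.refineStep (C.leftEnd s) s := by
  simp [leftEnd, List.range_succ]

@[fun_prop]
theorem computable_leftEnd {γ : Type*} [Primcodable γ] {f : γ → ℕ} (hf : Computable f) :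
    Computable fun a => C.leftEnd (f a) := by
  have h : Computable fun x : γ × ℕ × ℕ => C.refineStep x.2.1 x.2.2 := by
    unfold refineStep
    fun_prop
  exact computable_foldl (f := fun _ => C.refineStep) (by fun_prop) (by fun_prop) h

/-- The common point of the nested intervals. -/
noncomputable def baseRadius : ℝ := ⨆ s, (C.leftEnd s : ℝ) / 4 ^ s

theorem baseRadius_mem (s : ℕ) : C.leftEnd s ≤ C.baseRadius * 4 ^ s ∧
    C.baseRadius * 4 ^ s ≤ C.leftEnd s + 1 := by
  have h1 : ∀ s, (4 * C.leftEnd s : ℝ) ≤ C.leftEnd (s + 1) ∧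
      (C.leftEnd (s + 1) : ℝ) ≤ 4 * C.leftEnd s + 3 := by
    intro s
    rw [leftEnd_succ, refineStep]
    split_ifs <;> push_cast <;> constructor <;> linarith
  have h4 : ∀ s : ℕ, (0 : ℝ) < 4 ^ s := fun s => by positivity
  have h2 : Monotone fun s => (C.leftEnd s : ℝ) / 4 ^ s := by
    refine monotone_nat_of_le_succ fun s => ?_
    rw [div_le_div_iff₀ (h4 _) (h4 _), pow_succ]
    nlinarith [h1 s, h4 s]
  have h3 : Antitone fun s => ((C.leftEnd s : ℝ) + 1) / 4 ^ s := by
    refine antitone_nat_of_succ_le fun s => ?_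
    rw [div_le_div_iff₀ (h4 _) (h4 _), pow_succ]
    nlinarith [h1 s, h4 s]
  have h5 := mem_iInter.1 (h2.ciSup_mem_iInter_Icc_of_antitone h3 fun s => by
    exact div_le_div_of_nonneg_right (by linarith) (h4 s).le) s
  rw [mem_Icc, div_le_iff₀ (h4 s), le_div_iff₀ (h4 s)] at h5
  exact h5

theorem one_le_baseRadius : 1 ≤ C.baseRadius := by
  simpa [leftEnd] using (C.baseRadius_mem 0).1

theorem baseRadius_le_two : C.baseRadius ≤ 2 := by
  have := (C.baseRadius_mem 0).2
  norm_num [leftEnd] at this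
  exact this

theorem dist_mul_ne_baseRadius (m n e : ℕ) : dist (C.α m) (C.α n) * 2 ^ e ≠ C.baseRadius := by
  intro h
  set s := Nat.pair m (Nat.pair n e) with hs
  have h1 := C.baseRadius_mem (s + 1)
  have h2 := abs_le.1 (C.abs_distApprox m n (2 * s + e + 4))
  have h3 : dist (C.α m) (C.α n) * 2 ^ (2 * s + e + 4) = 16 * (C.baseRadius * 4 ^ s) := by
    rw [← h, show (4 : ℝ) = 2 ^ 2 by norm_num, ← pow_mul, pow_add, pow_add]
    ring
  rw [h3] at h2
  rw [pow_succ, ← mul_assoc, leftEnd_succ, refineStep] at h1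
  have e1 : s.unpair.1 = m := by simp [hs]
  have e2 : s.unpair.2.unpair.1 = n := by simp [hs]
  have e3 : s.unpair.2.unpair.2 = e := by simp [hs]
  rw [e1, e2, e3] at h1
  generalize C.baseRadius * 4 ^ s = y at *
  split_ifs at h1 with h4
  · rw [decide_eq_true_eq, ← Nat.cast_lt (α := ℝ)] at h4
    push_cast at h1 h4
    linarith
  · rw [decide_eq_true_eq, not_lt, ← Nat.cast_le (α := ℝ)] at h4
    push_cast at h1 h4
    linarith

/-- Approximations of the base radius: `baseApprox s` is `2 ^ s * baseRadius`, up to an error of at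
most `1`. -/
noncomputable def baseApprox (s : ℕ) : ℕ := C.leftEnd s / 2 ^ s

@[fun_prop]
theorem computable_baseApprox {γ : Type*} [Primcodable γ] {f : γ → ℕ} (hf : Computable f) :
    Computable fun a => C.baseApprox (f a) := by
  unfold baseApprox
  fun_prop

theorem baseApprox_spec (s : ℕ) : C.baseApprox s ≤ C.baseRadius * 2 ^ s ∧
    C.baseRadius * 2 ^ s ≤ C.baseApprox s + 1 := by
  obtain ⟨h1, h2⟩ := C.baseRadius_mem s
  have h3 : (0 : ℝ) < 2 ^ s := by positivity
  have h4 : (4 : ℝ) ^ s = 2 ^ s * 2 ^ s := by rw [← mul_pow]; norm_num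
  rw [h4, ← mul_assoc] at h1 h2
  have h5 : (C.baseApprox s : ℝ) * 2 ^ s ≤ C.leftEnd s := by
    exact_mod_cast Nat.div_mul_le_self (C.leftEnd s) (2 ^ s)
  have h6 : (C.leftEnd s : ℝ) + 1 ≤ (C.baseApprox s + 1) * 2 ^ s := by
    have : C.leftEnd s + 1 ≤ (C.baseApprox s + 1) * 2 ^ s := by
      have := Nat.lt_mul_div_succ (C.leftEnd s) (b := 2 ^ s) (by positivity)
      rw [mul_comm] at this
      exact this
    exact_mod_cast this
  exact ⟨le_of_mul_le_mul_right (h5.trans h1) h3, le_of_mul_le_mul_right (h2.trans h6) h3⟩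

/-- The `e`-th radius; it is between `2 ^ (-e)` and `2 ^ (1 - e)`. -/
noncomputable def radius (e : ℕ) : ℝ := C.baseRadius * (1 / 2) ^ e

theorem radius_pos (e : ℕ) : 0 < C.radius e :=
  mul_pos (by linarith [C.one_le_baseRadius]) (by positivity)

theorem radius_le (e : ℕ) : C.radius e ≤ 2 * (1 / 2) ^ e := by
  have := C.baseRadius_le_two
  unfold radius
  gcongr

theorem radius_mul (e : ℕ) : C.radius e * 2 ^ e = C.baseRadius := by
  rw [radius, mul_assoc, ← mul_pow]
  norm_num

theorem dist_ne_radius (m n e : ℕ) : dist (C.α m) (C.α n) ≠ C.radius e := fun h =>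
  C.dist_mul_ne_baseRadius m n e (by rw [h, radius_mul])

/-! ### Sides of spheres and cells -/

/-- The open ball (for `b = true`) or the open exterior (for `b = false`) of the sphere of radius
`radius e` around `α c`, where `t = (b, c, e)`. -/
def side (t : Bool × ℕ × ℕ) : Set X :=
  {x | if t.1 = true then dist x (C.α t.2.1) < C.radius t.2.2
    else C.radius t.2.2 < dist x (C.α t.2.1)}

/-- The formal inclusion of a ball in a side of a sphere. -/
noncomputable def sideTest (t : Bool × ℕ × ℕ) (n k : ℕ) : Bool :=
  if t.1 = true then decide ((C.distApprox n t.2.1 k + 3) * 2 ^ t.2.2 < C.baseApprox k)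
  else decide (C.baseApprox k + 1 + 3 * 2 ^ t.2.2 < C.distApprox n t.2.1 k * 2 ^ t.2.2)

@[fun_prop]
theorem computable_sideTest {γ : Type*} [Primcodable γ] {t : γ → Bool × ℕ × ℕ} {f g : γ → ℕ}
    (ht : Computable t) (hf : Computable f) (hg : Computable g) :
    Computable fun a => C.sideTest (t a) (f a) (g a) := by
  unfold sideTest
  fun_prop

theorem confirms_side (t : Bool × ℕ × ℕ) : C.Confirms (C.sideTest t) (C.side t) := by
  obtain ⟨b, c, e⟩ := t
  have he : (0 : ℝ) < 2 ^ e := by positivity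
  have hk2 : ∀ k : ℕ, (0 : ℝ) < 2 ^ k := fun k => by positivity
  have hr := C.radius_mul e
  set ρ := C.radius e with hρ
  have hT : ∀ k, (C.baseApprox k : ℝ) ≤ ρ * 2 ^ k * 2 ^ e ∧
      ρ * 2 ^ k * 2 ^ e ≤ C.baseApprox k + 1 := by
    intro k
    have h : ρ * 2 ^ k * 2 ^ e = C.baseRadius * 2 ^ k := by rw [← hr]; ring
    rw [h]
    exact C.baseApprox_spec k
  have hlarge : ∀ δ : ℝ, 0 < δ → ∃ k₀ : ℕ, ∀ k ≥ k₀, 7 < δ * 2 ^ k := by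
    intro δ hδ
    obtain ⟨k₀, hk₀⟩ := pow_unbounded_of_one_lt (7 / δ) (by norm_num : (1 : ℝ) < 2)
    refine ⟨k₀, fun k hk => ?_⟩
    have h1 : (2 : ℝ) ^ k₀ ≤ 2 ^ k := pow_le_pow_right₀ (by norm_num) hk
    have := (div_lt_iff₀ hδ).1 (hk₀.trans_le h1)
    linarith
  have he1 : (1 : ℝ) ≤ 2 ^ e := one_le_pow₀ (by norm_num)
  have hclose : ∀ (x : X) n (k : ℕ), dist x (C.α n) ≤ (1 / 2) ^ k → dist x (C.α n) * 2 ^ k ≤ 1 := by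
    intro x n k h
    calc _ ≤ (1 / 2 : ℝ) ^ k * 2 ^ k := by gcongr
      _ = 1 := by rw [← mul_pow]; norm_num
  cases b
  · have hside : C.side (false, c, e) = {x | ρ < dist x (C.α c)} := by
      simp only [side, Bool.false_eq_true, if_false, hρ]
    have htest : ∀ n k, C.sideTest (false, c, e) n k = true ↔
        (C.baseApprox k : ℝ) + 1 + 3 * 2 ^ e < C.distApprox n c k * 2 ^ e := by
      intro n k
      simp only [sideTest, Bool.false_eq_true, if_false, decide_eq_true_eq]
      rw [← Nat.cast_lt (α := ℝ)]
      push_cast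
      rfl
    rw [hside]
    constructor
    · intro n k h x hx
      rw [htest] at h
      have h1 := hclose x n k hx
      have h2 := (abs_le.1 (C.abs_distApprox n c k)).1
      have h3 := dist_triangle_left (C.α n) (C.α c) x
      have h4 : dist (C.α n) (C.α c) * 2 ^ k ≤ dist x (C.α n) * 2 ^ k + dist x (C.α c) * 2 ^ k := by
        rw [← add_mul]
        exact mul_le_mul_of_nonneg_right h3 (hk2 k).le
      have h5 : (C.distApprox n c k : ℝ) - 3 ≤ dist x (C.α c) * 2 ^ k := by linarith
      have h6 : ρ * 2 ^ k * 2 ^ e < (C.distApprox n c k - 3) * 2 ^ e := by linarith [(hT k).2]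
      have h7 : ρ * 2 ^ k < dist x (C.α c) * 2 ^ k :=
        (lt_of_mul_lt_mul_right h6 he.le).trans_le h5
      exact lt_of_mul_lt_mul_right h7 (hk2 k).le
    · intro x hx
      rw [mem_ofPred_eq] at hx
      obtain ⟨k₀, hk₀⟩ := hlarge ((dist x (C.α c) - ρ) / 2) (by linarith)
      refine ⟨(dist x (C.α c) - ρ) / 2, by linarith, k₀, fun k hk n hn => (htest n k).2 ?_⟩
      have h1 := hk₀ k hk
      have h2 := (abs_le.1 (C.abs_distApprox n c k)).2
      have h3 := dist_triangle x (C.α n) (C.α c)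
      have h4 : (ρ + (dist x (C.α c) - ρ) / 2) * 2 ^ k ≤ dist (C.α n) (C.α c) * 2 ^ k :=
        mul_le_mul_of_nonneg_right (by linarith) (hk2 k).le
      rw [add_mul] at h4
      have h5 : ρ * 2 ^ k + 5 < C.distApprox n c k := by linarith
      have h6 : (ρ * 2 ^ k + 5) * 2 ^ e < C.distApprox n c k * 2 ^ e :=
        mul_lt_mul_of_pos_right h5 he
      nlinarith [(hT k).1]
  · have hside : C.side (true, c, e) = {x | dist x (C.α c) < ρ} := by
      simp only [side, if_true, hρ]
    have htest : ∀ n k, C.sideTest (true, c, e) n k = true ↔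
        ((C.distApprox n c k : ℝ) + 3) * 2 ^ e < C.baseApprox k := by
      intro n k
      simp only [sideTest, if_true, decide_eq_true_eq]
      rw [← Nat.cast_lt (α := ℝ)]
      push_cast
      rfl
    rw [hside]
    constructor
    · intro n k h x hx
      rw [htest] at h
      have h1 := hclose x n k hx
      have h2 := (abs_le.1 (C.abs_distApprox n c k)).2
      have h3 := dist_triangle x (C.α n) (C.α c)
      have h4 : dist x (C.α c) * 2 ^ k ≤ dist x (C.α n) * 2 ^ k + dist (C.α n) (C.α c) * 2 ^ k := by
        rw [← add_mul]
        exact mul_le_mul_of_nonneg_right h3 (hk2 k).le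
      have h5 : dist x (C.α c) * 2 ^ k ≤ C.distApprox n c k + 3 := by linarith
      have h6 : ((C.distApprox n c k : ℝ) + 3) * 2 ^ e < ρ * 2 ^ k * 2 ^ e := by
        linarith [(hT k).1]
      have h7 : dist x (C.α c) * 2 ^ k < ρ * 2 ^ k :=
        h5.trans_lt (lt_of_mul_lt_mul_right h6 he.le)
      exact lt_of_mul_lt_mul_right h7 (hk2 k).le
    · intro x hx
      rw [mem_ofPred_eq] at hx
      obtain ⟨k₀, hk₀⟩ := hlarge ((ρ - dist x (C.α c)) / 2) (by linarith)
      refine ⟨(ρ - dist x (C.α c)) / 2, by linarith, k₀, fun k hk n hn => (htest n k).2 ?_⟩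
      have h1 := hk₀ k hk
      have h2 := (abs_le.1 (C.abs_distApprox n c k)).1
      have h3 := dist_triangle_left (C.α n) (C.α c) x
      have h4 : dist (C.α n) (C.α c) * 2 ^ k ≤ (ρ - (ρ - dist x (C.α c)) / 2) * 2 ^ k :=
        mul_le_mul_of_nonneg_right (by linarith) (hk2 k).le
      rw [sub_mul] at h4
      have h5 : (C.distApprox n c k : ℝ) + 5 < ρ * 2 ^ k := by linarith
      have h6 : ((C.distApprox n c k : ℝ) + 5) * 2 ^ e < ρ * 2 ^ k * 2 ^ e :=
        mul_lt_mul_of_pos_right h5 he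
      nlinarith [(hT k).2]

/-- As the radii avoid all distances of points of the dense sequence, each of these points is on
exactly one side of each sphere. -/
theorem mem_side_not (n : ℕ) (b : Bool) (s : ℕ × ℕ) :
    C.α n ∈ C.side (!b, s) ↔ C.α n ∉ C.side (b, s) := by
  have := C.dist_ne_radius n s.1 s.2
  cases b
  · simp only [side, Bool.not_false, if_true, Bool.false_eq_true, if_false, mem_ofPred_eq, not_lt]
    exact ⟨le_of_lt, fun h => h.lt_of_ne this⟩
  · simp only [side, Bool.not_true, if_true, Bool.false_eq_true, if_false, mem_ofPred_eq, not_lt]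
    exact ⟨le_of_lt, fun h => h.lt_of_ne this.symm⟩

theorem disjoint_side {x : X} {b b' : Bool} {s : ℕ × ℕ} (h : x ∈ C.side (b, s))
    (h' : x ∈ C.side (b', s)) : b = b' := by
  cases b <;> cases b' <;> simp [side] at h h' ⊢ <;> linarith

/-- The intersection of finitely many sides of spheres. -/
def cell (l : List (Bool × ℕ × ℕ)) : Set X := {x | ∀ t ∈ l, x ∈ C.side t}

/-- The formal inclusion of a ball in a cell. -/
noncomputable def cellTest (l : List (Bool × ℕ × ℕ)) (n k : ℕ) : Bool :=
  l.all fun t => C.sideTest t n k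

@[fun_prop]
theorem computable_cellTest {γ : Type*} [Primcodable γ] {l : γ → List (Bool × ℕ × ℕ)}
    {f g : γ → ℕ} (hl : Computable l) (hf : Computable f) (hg : Computable g) :
    Computable fun a => C.cellTest (l a) (f a) (g a) := by
  unfold cellTest
  fun_prop

theorem cell_cons (t : Bool × ℕ × ℕ) (l : List (Bool × ℕ × ℕ)) :
    C.cell (t :: l) = C.side t ∩ C.cell l := by
  ext x
  exact List.forall_mem_cons

theorem confirms_cell (l : List (Bool × ℕ × ℕ)) : C.Confirms (C.cellTest l) (C.cell l) := by
  induction l with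
  | nil => exact Confirms.univ.congr (by ext x; simp [cell])
  | cons t l ih => exact ((C.confirms_side t).inter ih).congr (C.cell_cons t l).symm

/-! ### A computable scheme of cells indexed by binary words -/

/-- A code `⟨⟨c, e⟩, ⟨m, s⟩⟩` passes the test for a cell if it is confirmed at precision `s` that the
sphere of radius `radius e` around `α c` splits the cell, with `α c` inside and `α m` outside. If
the point `α u` that is scheduled for this level is in the cell, then it has to be the centre. -/
noncomputable def splitTest (l : List (Bool × ℕ × ℕ)) (y : ℕ) : Bool :=
  C.cellTest l y.unpair.1.unpair.1 y.unpair.2.unpair.2 &&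
    C.cellTest l y.unpair.2.unpair.1 y.unpair.2.unpair.2 &&
    C.sideTest (false, y.unpair.1.unpair.1, y.unpair.1.unpair.2) y.unpair.2.unpair.1
      y.unpair.2.unpair.2 &&
    decide (l.length < y.unpair.1.unpair.2 + 1) &&
    ((y.unpair.1.unpair.1 == l.length.unpair.1) ||
      l.any fun t => C.sideTest (!t.1, t.2) l.length.unpair.1 y.unpair.2.unpair.2)

@[fun_prop]
theorem computable_splitTest {γ : Type*} [Primcodable γ] {l : γ → List (Bool × ℕ × ℕ)}
    {f : γ → ℕ} (hl : Computable l) (hf : Computable f) :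
    Computable fun a => C.splitTest (l a) (f a) := by
  unfold splitTest
  fun_prop

variable {C}

theorem splitTest_spec {l : List (Bool × ℕ × ℕ)} {y : ℕ} (h : C.splitTest l y = true) :
    (∀ b, (C.cell ((b, y.unpair.1.unpair) :: l)).Nonempty) ∧ l.length ≤ y.unpair.1.unpair.2 ∧
      (C.α l.length.unpair.1 ∈ C.cell l → y.unpair.1.unpair.1 = l.length.unpair.1) := by
  simp only [splitTest, Bool.and_eq_true, Bool.or_eq_true, decide_eq_true_eq, beq_iff_eq] at h
  obtain ⟨⟨⟨⟨h1, h2⟩, h3⟩, h4⟩, h5⟩ := h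
  have hself : ∀ n k, dist (C.α n) (C.α n) ≤ (1 / 2) ^ k := fun n k => by
    rw [dist_self]; positivity
  refine ⟨fun b => ?_, Nat.lt_succ_iff.1 h4, fun hu => h5.resolve_right fun h5 => ?_⟩
  · rw [cell_cons]
    cases b
    · exact ⟨_, (C.confirms_side _).mem_of_confirms h3 (hself _ _),
        (C.confirms_cell l).mem_of_confirms h2 (hself _ _)⟩
    · refine ⟨C.α y.unpair.1.unpair.1, ?_, (C.confirms_cell l).mem_of_confirms h1 (hself _ _)⟩
      simp [side, C.radius_pos]
  · obtain ⟨t, ht, h6⟩ := List.any_eq_true.1 h5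
    have h7 := (C.confirms_side _).mem_of_confirms h6 (hself _ _)
    exact (C.mem_side_not _ _ _).1 h7 (hu t ht)

theorem exists_splitTest [PerfectSpace X] {l : List (Bool × ℕ × ℕ)} (hl : (C.cell l).Nonempty) :
    ∃ y, C.splitTest l y = true := by
  have hO := (C.confirms_cell l).isOpen
  have hself : ∀ n k, dist (C.α n) (C.α n) ≤ (1 / 2) ^ k := fun n k => by
    rw [dist_self]; positivity
  obtain ⟨c, hc, s₀, hs₀⟩ : ∃ c, C.α c ∈ C.cell l ∧ ∃ s₀, ∀ s ≥ s₀, (c = l.length.unpair.1 ∨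
      (l.any fun t => C.sideTest (!t.1, t.2) l.length.unpair.1 s) = true) := by
    by_cases hu : C.α l.length.unpair.1 ∈ C.cell l
    · exact ⟨_, hu, 0, fun _ _ => Or.inl rfl⟩
    · obtain ⟨c, hc⟩ := (C.confirms_cell l).exists_index hl
      simp only [cell, mem_ofPred_eq, not_forall] at hu
      obtain ⟨t, ht, hu⟩ := hu
      obtain ⟨k, hk⟩ := (C.confirms_side _).exists_forall_ge ((C.mem_side_not _ t.1 t.2).2 hu)
      exact ⟨c, hc, k, fun s hs => Or.inr (List.any_eq_true.2 ⟨t, ht, hk s hs _ (hself _ _)⟩)⟩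
  have hinf : (C.cell l \ {C.α c}).Nonempty :=
    ((infinite_of_mem_nhds _ (hO.mem_nhds hc)).sdiff (finite_singleton _)).nonempty
  obtain ⟨m, hm, hmc⟩ := C.dense.exists_mem_open (hO.sdiff isClosed_singleton) hinf
  obtain ⟨e, he⟩ := exists_pow_lt_of_lt_one (half_pos (dist_pos.2 hmc))
    (by norm_num : (1 / 2 : ℝ) < 1)
  have hmside : C.α m ∈ C.side (false, c, max e l.length) := by
    have h1 := C.radius_le (max e l.length)
    have h2 : (1 / 2 : ℝ) ^ max e l.length ≤ (1 / 2) ^ e :=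
      pow_le_pow_of_le_one (by norm_num) (by norm_num) (le_max_left _ _)
    simp only [side, Bool.false_eq_true, if_false, mem_ofPred_eq]
    linarith
  obtain ⟨s₁, hs₁⟩ := (C.confirms_cell l).exists_forall_ge hc
  obtain ⟨s₂, hs₂⟩ := (C.confirms_cell l).exists_forall_ge hm
  obtain ⟨s₃, hs₃⟩ := (C.confirms_side _).exists_forall_ge hmside
  let s := s₀ + s₁ + s₂ + s₃
  refine ⟨Nat.pair (Nat.pair c (max e l.length)) (Nat.pair m s), ?_⟩
  simp only [splitTest, Bool.and_eq_true, Bool.or_eq_true, decide_eq_true_eq, beq_iff_eq,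
    Nat.unpair_pair]
  exact ⟨⟨⟨⟨hs₁ s (by omega) _ (hself _ _), hs₂ s (by omega) _ (hself _ _)⟩,
    hs₃ s (by omega) _ (hself _ _)⟩, Nat.lt_succ_of_le (le_max_right _ _)⟩, hs₀ s (by omega)⟩

variable (C)

open Classical in
/-- The sphere that splits a cell, given by the first code that passes the test. -/
noncomputable def split (l : List (Bool × ℕ × ℕ)) : ℕ × ℕ :=
  if h : ∃ y, C.splitTest l y = true then (Nat.find h).unpair.1.unpair else (0, 0)

/-- The list of sides that defines the cell of the word `w`. -/
noncomputable def history (w : List Bool) : List (Bool × ℕ × ℕ) :=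
  w.foldl (fun l b => (b, C.split l) :: l) []

theorem history_concat (w : List Bool) (b : Bool) :
    C.history (w ++ [b]) = (b, C.split (C.history w)) :: C.history w := by
  simp [history]

theorem length_history (w : List Bool) : (C.history w).length = w.length := by
  induction w using List.reverseRecOn with
  | nil => rfl
  | append_singleton w b ih => simp [history_concat, ih]

/-- The cell of the word `w`. -/
def wordCell (w : List Bool) : Set X := C.cell (C.history w)

theorem wordCell_concat (w : List Bool) (b : Bool) :
    C.wordCell (w ++ [b]) = C.side (b, C.split (C.history w)) ∩ C.wordCell w := by
  rw [wordCell, history_concat, cell_cons, wordCell]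

theorem confirms_wordCell (w : List Bool) :
    C.Confirms (C.cellTest (C.history w)) (C.wordCell w) := C.confirms_cell _

theorem wordCell_anti {v w : List Bool} (h : v <+: w) : C.wordCell w ⊆ C.wordCell v := by
  obtain ⟨u, rfl⟩ := h
  induction u using List.reverseRecOn with
  | nil => simp
  | append_singleton u b ih =>
    rw [← List.append_assoc, wordCell_concat]
    exact inter_subset_right.trans ih

theorem eq_of_mem_wordCell {x : X} {v w : List Bool} (hv : x ∈ C.wordCell v)
    (hw : x ∈ C.wordCell w) (h : v.length = w.length) : v = w := by
  induction v using List.reverseRecOn generalizing w with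
  | nil => exact (List.length_eq_zero_iff.1 h.symm).symm
  | append_singleton v b ih =>
    rcases List.eq_nil_or_concat w with rfl | ⟨w, b', rfl⟩
    · simp at h
    · rw [List.concat_eq_append] at hw h ⊢
      rw [wordCell_concat] at hv hw
      obtain rfl := ih hv.2 hw.2 (by simpa using h)
      rw [C.disjoint_side hv.1 hw.1]

theorem exists_wordCell (n k : ℕ) : ∃ w, w.length = k ∧ C.α n ∈ C.wordCell w := by
  induction k with
  | zero => exact ⟨[], rfl, by simp [wordCell, history, cell]⟩
  | succ k ih =>
    obtain ⟨w, hw, hn⟩ := ih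
    by_cases h : C.α n ∈ C.side (true, C.split (C.history w))
    · exact ⟨w ++ [true], by simp [hw], by rw [wordCell_concat]; exact ⟨h, hn⟩⟩
    · refine ⟨w ++ [false], by simp [hw], ?_⟩
      rw [wordCell_concat]
      exact ⟨(C.mem_side_not n true _).2 h, hn⟩

section Perfect

variable [PerfectSpace X]

theorem split_spec {l : List (Bool × ℕ × ℕ)} (hl : (C.cell l).Nonempty) :
    (∀ b, (C.cell ((b, C.split l) :: l)).Nonempty) ∧ l.length ≤ (C.split l).2 ∧
      (C.α l.length.unpair.1 ∈ C.cell l → (C.split l).1 = l.length.unpair.1) := by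
  classical
  have h := exists_splitTest hl
  have h1 : C.split l = (Nat.find h).unpair.1.unpair := by
    rw [split, dif_pos h]
  rw [h1]
  exact splitTest_spec (Nat.find_spec h)

theorem wordCell_nonempty (w : List Bool) : (C.wordCell w).Nonempty := by
  induction w using List.reverseRecOn with
  | nil => exact ⟨C.α 0, by simp [wordCell, history, cell]⟩
  | append_singleton w b ih =>
    rw [wordCell, history_concat]
    exact (C.split_spec ih).1 b

/-- Every nonempty open set contains a cell: a point of the dense sequence becomes the centre of
splitting spheres of arbitrarily small radius. -/
theorem exists_wordCell_subset {O : Set X} (hO : IsOpen O) (hne : O.Nonempty) :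
    ∃ w, C.wordCell w ⊆ O := by
  obtain ⟨n, hn⟩ := C.dense.exists_mem_open hO hne
  obtain ⟨ε, hε, hεO⟩ := Metric.isOpen_iff.1 hO _ hn
  obtain ⟨k, hk⟩ := exists_pow_lt_of_lt_one (half_pos hε) (by norm_num : (1 / 2 : ℝ) < 1)
  obtain ⟨w, hw, hnw⟩ := C.exists_wordCell n (Nat.pair n k)
  obtain ⟨-, h1, h2⟩ := C.split_spec (l := C.history w) ⟨_, hnw⟩
  rw [length_history, hw, Nat.unpair_pair] at h2
  rw [length_history, hw] at h1
  refine ⟨w ++ [true], fun x hx => hεO ?_⟩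
  rw [wordCell_concat] at hx
  have h3 := hx.1
  simp only [side, if_true, mem_ofPred_eq, h2 hnw] at h3
  have h4 := C.radius_le (C.split (C.history w)).2
  have h5 : (1 / 2 : ℝ) ^ (C.split (C.history w)).2 ≤ (1 / 2) ^ k :=
    pow_le_pow_of_le_one (by norm_num) (by norm_num) ((Nat.right_le_pair _ _).trans h1)
  rw [Metric.mem_ball]
  linarith

theorem computable_history' : Computable C.history := by
  have h := computable_search_rec (n := List.length) (S := fun w k => C.history (w.take k))
    (p := fun (x : List Bool × ℕ × List (Bool × ℕ × ℕ)) y => C.splitTest x.2.2 y)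
    (g := fun x y => (x.1.getD x.2.1 false, y.unpair.1.unpair) :: x.2.2) Computable.list_length
    (by simpa using Computable.const _) (by fun_prop) (by fun_prop) fun w k hk => by
      have h := exists_splitTest (C.wordCell_nonempty (w.take k))
      refine ⟨h, ?_⟩
      rw [List.take_add_one, List.getElem?_eq_getElem hk, Option.toList_some, history_concat,
        split, dif_pos h, List.getD_eq_getElem _ _ hk]
  simpa using h

@[fun_prop]
theorem computable_history {γ : Type*} [Primcodable γ] {f : γ → List Bool} (hf : Computable f) :
    Computable fun a => C.history (f a) :=
  C.computable_history'.comp hf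

end Perfect

/-! ### From a perfect space to Cantor space -/

variable {C}

/-- The word of length `m` that consists of the first binary digits of `v`. -/
def bits (v m : ℕ) : List Bool := (List.range m).map v.testBit

@[fun_prop]
theorem computable_bits {γ : Type*} [Primcodable γ] {f g : γ → ℕ} (hf : Computable f)
    (hg : Computable g) : Computable fun a => bits (f a) (g a) := by
  unfold bits
  fun_prop

theorem length_bits (v m : ℕ) : (bits v m).length = m := by simp [bits]

theorem getElem_bits {v m i : ℕ} (h : i < (bits v m).length) : (bits v m)[i] = v.testBit i := by
  simp [bits]

theorem bits_wordIndex (w : List Bool) : bits (wordIndex w) w.length = w := by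
  refine List.ext_getElem (length_bits _ _) fun i h1 h2 => ?_
  rw [getElem_bits, testBit_wordIndex, List.getD_eq_getElem _ _ h2]

theorem bits_prefix (v : ℕ) {m n : ℕ} (h : m ≤ n) : bits v m <+: bits v n :=
  (List.prefix_iff_eq_take.2 (by simp [List.take_range, h]) :
    List.range m <+: List.range n).map v.testBit

/-- A point that is in cells of arbitrarily long words determines a point of Cantor space, which can
be computed from any Cauchy name of the given point. -/
theorem exists_itinerary [PerfectSpace X] (C : ComputableMetricSpace X) :
    ∃ H : (ℕ → ℕ) →. (ℕ → ℕ), ComputableFun H ∧ ∀ s x, C.cauchy.names s x →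
      (∀ m, ∃ w, m ≤ w.length ∧ x ∈ C.wordCell w) → ∃ r ∈ H s, ∃ z : Cantor,
        cantorSpace.cauchy.names r z ∧ ∀ m, x ∈ C.wordCell (z.pre m) := by
  have h : Computable fun y : ℕ × ℕ × (ℕ × ℕ) =>
      C.cellTest (C.history (bits y.2.2.2 (y.2.2.1 + 2))) y.2.1 y.1.unpair.1 := by fun_prop
  obtain ⟨H, hH, h1⟩ := (Semi.of_entry (T := fun k v (y : ℕ × ℕ) =>
    C.cellTest (C.history (bits y.2 (y.1 + 2))) v k.unpair.1) h).exists_choice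
  refine ⟨H, hH, fun s x hs hx => ?_⟩
  have h2 : ∀ w, (∃ k : ℕ, C.cellTest (C.history w) (s k.unpair.1) k.unpair.1 = true) ↔
      x ∈ C.wordCell w := by
    intro w
    rw [← (C.confirms_wordCell w).exists_iff_of_cauchy (dist_le_of_cauchy hs)]
    constructor
    · rintro ⟨k, hk⟩
      exact ⟨_, hk⟩
    · rintro ⟨k, hk⟩
      exact ⟨Nat.pair k 0, by simpa using hk⟩
  obtain ⟨r, hr, h3⟩ := h1 s fun n => by
    obtain ⟨w, hw, hxw⟩ := hx (n + 2)
    refine ⟨wordIndex (w.take (n + 2)), (h2 _).2 ?_⟩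
    have hl : (w.take (n + 2)).length = n + 2 := by simp [hw]
    have h4 := bits_wordIndex (w.take (n + 2))
    rw [hl] at h4
    rw [h4]
    exact C.wordCell_anti (List.take_prefix _ _) hxw
  have h4 : ∀ n, x ∈ C.wordCell (bits (r n) (n + 2)) := fun n => (h2 _).1 (h3 n)
  let z : Cantor := fun i => (r i).testBit i
  have h5 : ∀ n, ∀ i < n + 2, z i = (r n).testBit i := by
    intro n i hi
    have h6 : bits (r i) (i + 1) = bits (r n) (i + 1) :=
      C.eq_of_mem_wordCell (C.wordCell_anti (bits_prefix _ (by omega)) (h4 i))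
        (C.wordCell_anti (bits_prefix _ (by omega)) (h4 n)) (by simp [length_bits])
    have h7 : i < (bits (r i) (i + 1)).length := by simp [length_bits]
    have h8 := getElem_bits h7
    rw [show z i = (r i).testBit i from rfl, ← h8]
    simp only [h6, getElem_bits]
  refine ⟨r, hr, z, cauchy_of_dist fun k => ?_, fun m => ?_⟩
  · refine lt_of_le_of_lt ((Cantor.dist_le_iff (n := k + 2)).2 fun i hi => h5 k i hi) ?_
    exact pow_lt_pow_right_of_lt_one₀ (by norm_num) (by norm_num) (Nat.lt_succ_self _)
  · have h6 : z.pre m = bits (r m) m :=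
      List.map_congr_left fun i hi => h5 m i (by have := List.mem_range.1 hi; omega)
    rw [h6]
    exact C.wordCell_anti (bits_prefix _ (by omega)) (h4 m)

variable [CompleteSpace X]

/-- A set of words with dense union of cylinders has a dense union of cells, which is semidecidable
in the limit; a generic point is in cells of arbitrarily long words and hence has an itinerary. -/
theorem Pi01G_strongReducible_jump_BCT0 [PerfectSpace X] :
    Pi01G.StrongReducible C.BCT0.jump := by
  obtain ⟨Q, hQ, hQE⟩ := exists_semi_not_mem_words
  -- the index `⟨⟨v, v'⟩, ⟨n, k⟩⟩` stands for a ball in the cells of `v` and of a long word `v'`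
  have h1 : Computable fun x : ℕ × ℕ =>
      !(C.cellTest (C.history (wordAt x.2.unpair.1.unpair.1)) x.2.unpair.2.unpair.1
          x.2.unpair.2.unpair.2 &&
        C.cellTest (C.history (wordAt x.2.unpair.1.unpair.2)) x.2.unpair.2.unpair.1
          x.2.unpair.2.unpair.2 &&
        decide (x.1 < (wordAt x.2.unpair.1.unpair.2).length + 1)) := by fun_prop
  have h2 := (hQ.comp (f := fun x : ℕ × ℕ => (x.1, wordAt x.2.unpair.1.unpair.1))
    (by fun_prop)).or (Semi.of_computable h1)
  obtain ⟨K, hK, h⟩ := C.exists_limit_name_seq h2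
    (c := fun y => ballCode y.unpair.2.unpair.1 y.unpair.2.unpair.2) (by fun_prop)
  obtain ⟨H, hH, hH'⟩ := C.exists_itinerary
  refine Problem.StrongReducible.of_forall hK hH fun p A hp hA => ?_
  obtain ⟨q, hq, h'⟩ := h p
  choose E hE hAE using hp
  let U : ℕ → Set X := fun i =>
    ⋃ v, ⋃ v', ⋃ _ : v ∈ E i ∧ i ≤ List.length v', C.wordCell v ∩ C.wordCell v'
  have hU : ∀ i, IsOpen (U i) := fun i => isOpen_iUnion fun v => isOpen_iUnion fun v' =>
    isOpen_iUnion fun _ => (C.confirms_wordCell v).isOpen.inter (C.confirms_wordCell v').isOpen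
  let B : ℕ → Closeds X := fun i => ⟨(U i)ᶜ, (hU i).isClosed_compl⟩
  have hB : ∀ i x, x ∉ B i ↔ ∃ v v', v ∈ E i ∧ i ≤ List.length v' ∧ x ∈ C.wordCell v ∧
      x ∈ C.wordCell v' := by
    intro i x
    change ¬ x ∈ (U i)ᶜ ↔ _
    simp only [mem_compl_iff, not_not, U, mem_iUnion, exists_prop, mem_inter_iff, and_assoc]
  refine ⟨q, hq, B, h' B fun i => ?_, fun i => ?_, fun s x hs hx => ?_⟩
  · change (U i)ᶜ = _
    rw [compl_inj_iff]
    ext x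
    simp only [not_or, Bool.not_eq_true', Bool.not_eq_false, Bool.and_eq_true, decide_eq_true_eq,
      Nat.lt_succ_iff, mem_iUnion, exists_prop, U]
    constructor
    · rintro ⟨v, v', ⟨hv, hv'⟩, hx⟩
      have hcode : wordAt (Encodable.encode (show List Bool from v)) = v := wordAt_encode _
      rw [((C.confirms_wordCell v).inter (C.confirms_wordCell v')).eq_iUnion] at hx
      simp only [mem_iUnion, exists_prop, Bool.and_eq_true] at hx
      obtain ⟨n, k, hT, hx⟩ := hx
      refine ⟨Nat.pair (Nat.pair (Encodable.encode (show List Bool from v)) (Encodable.encode v'))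
        (Nat.pair n k), ?_⟩
      simp only [Nat.unpair_pair, wordAt_encode, hcode]
      exact ⟨⟨fun hc => (hQE p i (E i) (hE i) v).1 hc hv, hT, hv'⟩, hx⟩
    · rintro ⟨y, ⟨hv, hT, hv'⟩, hx⟩
      refine ⟨_, _, ⟨not_not.1 fun hc => hv ((hQE p i (E i) (hE i) _).2 hc), hv'⟩, ?_⟩
      rw [ball_ballCode] at hx
      exact ((C.confirms_wordCell _).inter (C.confirms_wordCell _)).mem_of_confirms
        (by rw [Bool.and_eq_true]; exact hT) (Metric.mem_ball.1 hx).le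
  · change interior (U i)ᶜ = ∅
    rw [interior_eq_empty_iff_dense_compl, compl_compl]
    refine dense_iff_inter_open.2 fun O hO hne => ?_
    obtain ⟨w, hw⟩ := C.exists_wordCell_subset hO hne
    obtain ⟨z, hzA, hzw⟩ := (interior_eq_empty_iff_dense_compl.1 (hA i)).exists_mem_open
      (isOpen_cyl w) (cyl_nonempty w)
    rw [mem_compl_iff, hAE i, mem_compl_iff, not_not, mem_iUnion₂] at hzA
    obtain ⟨v, hv, hzv⟩ := hzA
    let m := max i (max (List.length v) w.length)
    have hvm : List.length v ≤ m := (le_max_left _ _).trans (le_max_right _ _)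
    have hwm : w.length ≤ m := (le_max_right _ _).trans (le_max_right _ _)
    obtain ⟨x, hx⟩ := C.wordCell_nonempty (z.pre m)
    refine ⟨x, hw (C.wordCell_anti ((mem_cyl_iff_prefix hwm).1 hzw) hx), ?_⟩
    refine mem_iUnion.2 ⟨v, mem_iUnion.2 ⟨z.pre m, mem_iUnion.2 ⟨⟨hv, ?_⟩, ?_, hx⟩⟩⟩
    · rw [z.length_pre]
      exact le_max_left _ _
    · exact C.wordCell_anti ((mem_cyl_iff_prefix hvm).1 hzv) hx
  · have hx' : ∀ i, x ∉ B i := fun i hi => hx (mem_iUnion.2 ⟨i, hi⟩)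
    obtain ⟨r, hr, z, hrz, hz⟩ := hH' s x hs fun m => by
      obtain ⟨v, v', -, hv', -, hx⟩ := (hB m x).1 (hx' m)
      exact ⟨v', hv', hx⟩
    refine ⟨r, hr, z, hrz, fun hzA => ?_⟩
    obtain ⟨i, hi⟩ := mem_iUnion.1 hzA
    obtain ⟨v, v', hv, -, hxv, -⟩ := (hB i x).1 (hx' i)
    rw [hAE i] at hi
    refine hi (mem_iUnion₂.2 ⟨v, hv, mem_cyl_iff.2 ?_⟩)
    exact C.eq_of_mem_wordCell (hz _) hxv (z.length_pre _)

end ComputableMetricSpace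

end CompAnalysis

theorem corollary8p3 :
    -- the jump of the negative representation on Cantor space is computably equivalent to `ψ_#`
    (cantorSpace.psiNeg.jump.Reducible psiSharp ∧ psiSharp.Reducible cantorSpace.psiNeg.jump) ∧
    -- strong Weihrauch equivalences for every computable perfect Polish space
    ∀ (X : Type*) [MetricSpace X] [CompleteSpace X] [PerfectSpace X]
      (C : ComputableMetricSpace X),
      Pi01G.StrongEquiv C.BCT2 ∧ C.BCT2.StrongEquiv C.BCT0.jump ∧ Pi01G.StrongEquiv C.BCT0.jump := by
  refine ⟨⟨jump_psiNeg_reducible_psiSharp, psiSharp_reducible_jump_psiNeg⟩, ?_⟩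
  intro X _ _ _ C
  have h1 : Pi01G.StrongReducible C.BCT0.jump := ComputableMetricSpace.Pi01G_strongReducible_jump_BCT0
  have h2 : C.BCT0.jump.StrongReducible C.BCT2 :=
    ComputableMetricSpace.jump_BCT0_strongReducible_BCT2
  have h3 : C.BCT2.StrongReducible C.BCT0.jump :=
    ComputableMetricSpace.BCT2_strongReducible_jump_BCT0
  have h4 : C.BCT0.jump.StrongReducible Pi01G :=
    ComputableMetricSpace.jump_BCT0_strongReducible_Pi01G
  exact ⟨⟨h1.trans h2, h3.trans h4⟩, ⟨h3, h2⟩, h1, h4⟩
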